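/- Let $\mu$ be the uniform (Lebesgue) probability measure on $X=\mathbb R/\mathbb Z$, identified with $[0,1)$. For a real function $f$ on $X$ let $\mathrm V(f)$ be its variation computed on $[0,1)$; $f$ is called BV if $\mathrm V(f)<\infty$, and centered if $\int_X f\,d\mu=0$. Let $\|\cdot\|_\infty$ and $\|\cdot\|_2$ be the norms of $L^\infty(\mu)$ and $L^2(\mu)$. For real random variables $Z,Y$ let $d(Z,Y)=\sup_{x\in\mathbb R}|\mathbb P(Z\le x)-\mathbb P(Y\le x)|$ be the Kolmogorov distance of their distributions, and let $Y_1$ be a random variable with distribution $\mathcal N(0,1)$. **Proposition.** Let $C>0$, $\theta\in\mathbb R$, $\rho<1$ be constants. For every $\delta>0$ there is a constant $C(\delta)>0$, depending only on $\delta$, $C$, $\theta$ and $\rho$, such that the following holds for every $n\ge 1$. Let $(q_k)_{1\le k\le n}$ be an increasing (not necessarily strictly) sequence of positive integers which is lacunary in the sense that $$\frac{q_k}{q_m}\le C\,\rho^{\,m-k},\qquad 1\le k<m\le n .$$ Let $(f_k)_{1\le k\le n}$ be real centered BV functions on $X$ and $(u_k)_{1\le k\le n}$ real constants such that $$\|f_k\|_\infty\le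 u_k,\qquad \mathrm V(f_k)\le C\,u_k\,q_k,\qquad 1\le k\le n .$$ Suppose that for every real centered BV function $\psi$ on $X$ $$\Big|\int_X\psi f_k\,d\mu\Big|\le C\,\mathrm V(\psi)\,u_k\,\frac{k^\theta}{q_k},\qquad 1\le k\le n,$$ $$\Big|\int_X\psi f_kf_m\,d\mu\Big|\le C\,\mathrm V(\psi)\,u_ku_m\,\frac{m^\theta}{q_k},\qquad 1\le k\le m\le n,$$ $$\Big|\int_X\psi f_kf_mf_t\,d\mu\Big|\le C\,\mathrm V(\psi)\,u_ku_mu_t\,\frac{t^\theta}{q_k},\qquad 1\le k\le m\le t\le n .$$ If $\|f_1+\dots+f_n\|_2\ne 0$, then $$d\Big(\frac{f_1+\dots+f_n}{\|f_1+\dots+f_n\|_2},\,Y_1\Big)\le C(\delta)\,\Big(\frac{\max_{1\le j\le n}u_j}{\|f_1+\dots+f_n\|_2}\Big)^{2/3}\,n^{\frac14+\delta}.$$ -/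

import Mathlib

open MeasureTheory ProbabilityTheory

noncomputable section

/-- The uniform probability measure on the circle, identified with `[0, 1)`. A function on the
circle is represented by a function `ℝ → ℝ` of which only the values on `[0, 1)` matter. -/
def circleMeasure : Measure ℝ := volume.restrict (Set.Ico 0 1)

/-- The variation of `f`, computed for its restriction to `[0, 1)`. It is the true variation
whenever `f` has bounded variation on `[0, 1)`. -/
def circleVariation (f : ℝ → ℝ) : ℝ := (eVariationOn f (Set.Ico 0 1)).toReal

/-- Real functions on the circle of bounded variation and with zero mean. -/
structure IsCenteredBV (f : ℝ → ℝ) : Prop where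
  boundedVariation : BoundedVariationOn f (Set.Ico 0 1)
  integral_eq_zero : ∫ x, f x ∂circleMeasure = 0

/-- The Kolmogorov distance between (the distributions of) a real random variable `X` under the
probability measure `P` and a real random variable `Y` under the probability measure `Q`. -/
def kolmogorovDist {Ω Ω' : Type*} [MeasurableSpace Ω] [MeasurableSpace Ω']
    (P : Measure Ω) (X : Ω → ℝ) (Q : Measure Ω') (Y : Ω' → ℝ) : ℝ :=
  ⨆ x : ℝ, |P.real {ω | X ω ≤ x} - Q.real {ω | Y ω ≤ x}|

end

/-! Divide by the largest bound, so that all functions are bounded by one, and let `S k` be the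
partial sums, with second moments `V k` and `V n = σ ^ 2`. A centered Lipschitz function of `S j` is
BV with variation controlled by `q 1 + … + q j`, so by lacunarity the correlation hypotheses bound
its correlation with a later function, or with a product of two, by a power of `n` times `ρ ^ L`
after a gap of length `L`. A gap of order `log n` makes this error `η` at most `1 / n`. From then on
only `IsWeaklyDependent` matters.

The central limit theorem for a smooth test function `h` is a Lindeberg argument along the heat flow
(`IsWeaklyDependent.abs_integral_sub_heat_le`). Interpolate by `A k = E (heat (t k) h) (S k)`, where
`t k` is the variance still to come. To second order, passing from `S k` to `S (k + 1)` adds `(V (k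
+ 1) - V k) / 2` times the mean second derivative, and the heat equation, used for the change of
time, removes it again. Each step therefore leaves an error of order `L ^ 2` times the Lipschitz
constant of `h''`, plus a multiple of `η`.

Indicators of half-lines are squeezed between smooth steps of width `ε * σ`, whose third order
constant is of order `(ε * σ) ^ (-3)`. Hence the distance is at most `ε` plus a constant times `n *
L ^ 4 / (ε * σ) ^ 3` (`exists_kolmogorovDist_le`). Taking for `ε` the claimed rate `σ ^ (-2/3) * n ^
(1/4 + δ)` balances the two terms, the logarithmic gap being absorbed by `n ^ δ`. -/

open scoped NNReal

/-! ### Smooth test functions and their Taylor expansions -/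

/-- `h₀` is bounded and twice differentiable with derivatives `h₁` and `h₂`, where `h₁` is bounded
by `B`, `h₂` by `M₂`, and `h₂` is `M₃`-Lipschitz. -/
structure IsTestFunction (h₀ h₁ h₂ : ℝ → ℝ) (B M₂ M₃ : ℝ) : Prop where
  deriv₀ : ∀ x, HasDerivAt h₀ (h₁ x) x
  deriv₁ : ∀ x, HasDerivAt h₁ (h₂ x) x
  bound₀ : ∀ x, |h₀ x| ≤ B
  bound₁ : ∀ x, |h₁ x| ≤ B
  bound₂ : ∀ x, |h₂ x| ≤ M₂
  lipschitz : ∀ x y, |h₂ x - h₂ y| ≤ M₃ * |x - y|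

namespace IsTestFunction

variable {h₀ h₁ h₂ : ℝ → ℝ} {B M₂ M₃ : ℝ}

lemma M₃_nonneg (h : IsTestFunction h₀ h₁ h₂ B M₂ M₃) : 0 ≤ M₃ := by
  simpa using (abs_nonneg _).trans (h.lipschitz 1 0)

lemma M₂_nonneg (h : IsTestFunction h₀ h₁ h₂ B M₂ M₃) : 0 ≤ M₂ :=
  (abs_nonneg _).trans (h.bound₂ 0)

lemma continuous₀ (h : IsTestFunction h₀ h₁ h₂ B M₂ M₃) : Continuous h₀ :=
  continuous_iff_continuousAt.2 fun x => (h.deriv₀ x).continuousAt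

lemma continuous₁ (h : IsTestFunction h₀ h₁ h₂ B M₂ M₃) : Continuous h₁ :=
  continuous_iff_continuousAt.2 fun x => (h.deriv₁ x).continuousAt

lemma lipschitzWith₂ (h : IsTestFunction h₀ h₁ h₂ B M₂ M₃) : LipschitzWith M₃.toNNReal h₂ :=
  LipschitzWith.of_dist_le_mul fun x y => by
    rw [Real.coe_toNNReal _ h.M₃_nonneg]
    exact h.lipschitz x y

lemma continuous₂ (h : IsTestFunction h₀ h₁ h₂ B M₂ M₃) : Continuous h₂ :=
  h.lipschitzWith₂.continuous

lemma abs_sub_le₁ (h : IsTestFunction h₀ h₁ h₂ B M₂ M₃) (x y : ℝ) :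
    |h₁ x - h₁ y| ≤ M₂ * |x - y| :=
  Convex.norm_image_sub_le_of_norm_hasDerivWithin_le (s := Set.univ)
    (fun z _ => (h.deriv₁ z).hasDerivWithinAt) (fun z _ => h.bound₂ z) convex_univ
    (Set.mem_univ _) (Set.mem_univ _)

lemma lipschitzWith₁ (h : IsTestFunction h₀ h₁ h₂ B M₂ M₃) : LipschitzWith M₂.toNNReal h₁ :=
  LipschitzWith.of_dist_le_mul fun x y => by
    rw [Real.coe_toNNReal _ h.M₂_nonneg]
    exact h.abs_sub_le₁ x y

/-- Mean value inequality for `h₁` minus its linear part at `x`; a Lipschitz bound on `h₂` replaces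
a third derivative. The same device, once more, gives `taylor₀`. The constants are not optimized. -/
lemma taylor₁ (h : IsTestFunction h₀ h₁ h₂ B M₂ M₃) (x y : ℝ) :
    |h₁ (x + y) - h₁ x - h₂ x * y| ≤ M₃ * y ^ 2 := by
  have key := Convex.norm_image_sub_le_of_norm_hasDerivWithin_le (s := Set.uIcc x (x + y))
    (f := fun z => h₁ z - h₂ x * z) (f' := fun z => h₂ z - h₂ x * 1) (C := M₃ * |y|)
    (fun z _ => ((h.deriv₁ z).sub ((hasDerivAt_id z).const_mul (h₂ x))).hasDerivWithinAt)
    (fun z hz => ?_) (convex_uIcc _ _) (Set.left_mem_uIcc) (Set.right_mem_uIcc)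
  · simp only [Real.norm_eq_abs, add_sub_cancel_left] at key
    calc _ = |h₁ (x + y) - h₂ x * (x + y) - (h₁ x - h₂ x * x)| := by congr 1; ring
      _ ≤ _ := key
      _ = M₃ * y ^ 2 := by rw [mul_assoc, abs_mul_abs_self, sq]
  · have h1 := Set.abs_sub_left_of_mem_uIcc hz
    rw [add_sub_cancel_left] at h1
    rw [mul_one]
    exact (h.lipschitz z x).trans (mul_le_mul_of_nonneg_left h1 h.M₃_nonneg)

lemma taylor₀ (h : IsTestFunction h₀ h₁ h₂ B M₂ M₃) (x y : ℝ) :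
    |h₀ (x + y) - h₀ x - h₁ x * y - h₂ x / 2 * y ^ 2| ≤ M₃ * |y| ^ 3 := by
  have key := Convex.norm_image_sub_le_of_norm_hasDerivWithin_le (s := Set.uIcc 0 y)
    (f := fun z => h₀ (x + z) - h₁ x * z - h₂ x / 2 * z ^ 2)
    (f' := fun z => h₁ (x + z) - h₁ x * 1 - h₂ x / 2 * (2 * z)) (C := M₃ * y ^ 2)
    (fun z _ => ((((h.deriv₀ (x + z)).comp_const_add x z).sub
      ((hasDerivAt_id z).const_mul (h₁ x))).sub
      (((hasDerivAt_pow 2 z).congr_deriv (by norm_num)).const_mul (h₂ x / 2))).hasDerivWithinAt)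
    (fun z hz => ?_) (convex_uIcc _ _) (Set.left_mem_uIcc) (Set.right_mem_uIcc)
  · simp only [Real.norm_eq_abs] at key
    calc _ = _ := by rw [add_zero]; congr 1; ring
      _ ≤ _ := key
      _ = M₃ * |y| ^ 3 := by rw [sub_zero, ← sq_abs y]; ring
  · have h1 := Set.abs_sub_left_of_mem_uIcc hz
    rw [sub_zero, sub_zero] at h1
    calc _ = |h₁ (x + z) - h₁ x - h₂ x * z| := by rw [Real.norm_eq_abs]; congr 1; ring
      _ ≤ M₃ * z ^ 2 := h.taylor₁ x z
      _ ≤ _ := mul_le_mul_of_nonneg_left (sq_le_sq.2 h1) h.M₃_nonneg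

end IsTestFunction

/-! ### The heat semigroup and its expansion in time -/

/-- The heat semigroup on functions on the line, in the normalization of Brownian motion. -/
noncomputable def heat (t : ℝ≥0) (h : ℝ → ℝ) (x : ℝ) : ℝ := ∫ y, h (x + y) ∂gaussianReal 0 t

section heat

variable {h : ℝ → ℝ} {B : ℝ}

lemma integrable_of_continuous_of_abs_le {α : Type*} [MeasurableSpace α] [TopologicalSpace α]
    [OpensMeasurableSpace α] {μ : Measure α} [IsFiniteMeasure μ] {g : α → ℝ} (hg : Continuous g)
    (hB : ∀ x, |g x| ≤ B) : Integrable g μ :=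
  Integrable.of_bound hg.measurable.aestronglyMeasurable B (ae_of_all _ hB)

lemma abs_heat_le (t : ℝ≥0) (hB : ∀ x, |h x| ≤ B) (x : ℝ) : |heat t h x| ≤ B := by
  have := norm_integral_le_of_norm_le_const (μ := gaussianReal 0 t) (f := fun y => h (x + y))
    (ae_of_all _ fun y => hB (x + y))
  simpa [heat] using this

lemma heat_add (s t : ℝ≥0) (hc : Continuous h) (hB : ∀ x, |h x| ≤ B) (x : ℝ) :
    heat (s + t) h x = heat t (heat s h) x := by
  have hconv : gaussianReal 0 (s + t) = gaussianReal 0 t ∗ gaussianReal 0 s := by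
    rw [gaussianReal_conv_gaussianReal, add_comm s t, zero_add]
  have hint : Integrable (fun y => h (x + y)) (gaussianReal 0 t ∗ gaussianReal 0 s) :=
    integrable_of_continuous_of_abs_le (by fun_prop) fun y => hB _
  simp only [heat]
  rw [hconv, integral_conv hint]
  simp only [add_assoc]

lemma hasDerivAt_heat (t : ℝ≥0) {h' : ℝ → ℝ} (hd : ∀ x, HasDerivAt h (h' x) x)
    (hc' : Continuous h') (hB : ∀ x, |h x| ≤ B) {B' : ℝ} (hB' : ∀ x, |h' x| ≤ B') (x : ℝ) :
    HasDerivAt (heat t h) (heat t h' x) x := by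
  have hc : Continuous h := continuous_iff_continuousAt.2 fun x => (hd x).continuousAt
  refine (hasDerivAt_integral_of_dominated_loc_of_deriv_le (μ := gaussianReal 0 t)
    (F := fun x y => h (x + y)) (F' := fun x y => h' (x + y)) (x₀ := x) (s := Set.univ)
    (bound := fun _ => B') Filter.univ_mem ?_ ?_ ?_ ?_ ?_ ?_).2
  · exact .of_forall fun z => (Continuous.measurable (by fun_prop)).aestronglyMeasurable
  · exact integrable_of_continuous_of_abs_le (by fun_prop) fun y => hB _
  · exact (Continuous.measurable (by fun_prop)).aestronglyMeasurable
  · exact ae_of_all _ fun y z _ => hB' _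
  · exact integrable_const _
  · exact ae_of_all _ fun y z _ => (hd (z + y)).comp_add_const z y

lemma integrable_abs_pow_gaussianReal (t : ℝ≥0) (k : ℕ) :
    Integrable (fun y : ℝ => |y| ^ k) (gaussianReal 0 t) := by
  have := (memLp_id_gaussianReal (μ := 0) (v := t) (k : ℝ≥0)).integrable_norm_pow'
  simpa using this

lemma integral_sq_gaussianReal (t : ℝ≥0) : ∫ y, y ^ 2 ∂gaussianReal 0 t = t := by
  have h := variance_fun_id_gaussianReal (μ := 0) (v := t)
  rw [variance_eq_integral (by fun_prop)] at h
  simpa using h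

lemma integral_abs_cube_gaussianReal (t : ℝ≥0) :
    ∫ y, |y| ^ 3 ∂gaussianReal 0 t = √t ^ 3 * ∫ y, |y| ^ 3 ∂gaussianReal 0 1 := by
  have h : gaussianReal 0 t = (gaussianReal 0 1).map (√(t : ℝ) * ·) := by
    rw [gaussianReal_map_const_mul]
    congr
    · simp
    · ext; simp
  rw [h, integral_map (by fun_prop) (by fun_prop), ← integral_const_mul]
  simp [abs_mul, mul_pow, abs_of_nonneg (Real.sqrt_nonneg _)]

lemma abs_heat_sub_le (t : ℝ≥0) {M : ℝ} (hc : Continuous h) (hB : ∀ x, |h x| ≤ B)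
    (hM : 0 ≤ M) (hL : ∀ x y, |h x - h y| ≤ M * |x - y|) (x : ℝ) :
    |heat t h x - h x| ≤ M * (1 + t) := by
  have h1 : heat t h x - h x = ∫ y, (h (x + y) - h x) ∂gaussianReal 0 t := by
    rw [integral_sub (integrable_of_continuous_of_abs_le (by fun_prop) fun y => hB _)
      (integrable_const _)]
    simp [heat]
  have h2 : Integrable (fun y : ℝ => M * (1 + y ^ 2)) (gaussianReal 0 t) := by
    have := integrable_abs_pow_gaussianReal t 2
    simp only [sq_abs] at this
    exact ((integrable_const _).add this).const_mul M
  rw [h1]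
  refine (norm_integral_le_of_norm_le (f := fun y => h (x + y) - h x) h2
    (ae_of_all _ fun y => ?_)).trans_eq ?_
  · refine (hL _ _).trans (mul_le_mul_of_nonneg_left ?_ hM)
    rw [add_sub_cancel_left]
    nlinarith [sq_abs y, sq_nonneg (|y| - 1)]
  · have := integrable_abs_pow_gaussianReal t 2
    simp only [sq_abs] at this
    rw [integral_const_mul, integral_add (integrable_const _) this, integral_sq_gaussianReal]
    simp

end heat

namespace IsTestFunction

variable {h₀ h₁ h₂ : ℝ → ℝ} {B M₂ M₃ : ℝ}

lemma heat (h : IsTestFunction h₀ h₁ h₂ B M₂ M₃) (t : ℝ≥0) :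
    IsTestFunction (heat t h₀) (heat t h₁) (heat t h₂) B M₂ M₃ where
  deriv₀ := hasDerivAt_heat t h.deriv₀ h.continuous₁ h.bound₀ h.bound₁
  deriv₁ := hasDerivAt_heat t h.deriv₁ h.continuous₂ h.bound₁ h.bound₂
  bound₀ := abs_heat_le t h.bound₀
  bound₁ := abs_heat_le t h.bound₁
  bound₂ := abs_heat_le t h.bound₂
  lipschitz x y := by
    have hc := h.continuous₂
    have hi (x : ℝ) : Integrable (fun z => h₂ (x + z)) (gaussianReal 0 t) :=
      integrable_of_continuous_of_abs_le (by fun_prop) fun z => h.bound₂ _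
    have := norm_integral_le_of_norm_le_const (μ := gaussianReal 0 t) (C := M₃ * |x - y|)
      (f := fun z => h₂ (x + z) - h₂ (y + z)) (ae_of_all _ fun z => by
        simpa using h.lipschitz (x + z) (y + z))
    rw [integral_sub (hi x) (hi y)] at this
    simpa [_root_.heat] using this

/-- Integrate `taylor₀` against the Gaussian: the linear term vanishes, the quadratic one gives `t /
2`, and the remainder is the third absolute moment, of order `t ^ (3 / 2) ≤ t + t ^ 2`. -/
lemma abs_heat_sub_sub_le (h : IsTestFunction h₀ h₁ h₂ B M₂ M₃) (t : ℝ≥0) (x : ℝ) :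
    |_root_.heat t h₀ x - h₀ x - t / 2 * h₂ x| ≤
      M₃ * ((∫ y, |y| ^ 3 ∂gaussianReal 0 1) * (t + t ^ 2)) := by
  have hc₀ := h.continuous₀
  have i0 : Integrable (fun y => h₀ (x + y)) (gaussianReal 0 t) :=
    integrable_of_continuous_of_abs_le (by fun_prop) fun y => h.bound₀ _
  have i1 : Integrable (fun y : ℝ => h₁ x * y) (gaussianReal 0 t) := by
    have := (memLp_id_gaussianReal (μ := 0) (v := t) 1).integrable le_rfl
    exact this.const_mul _
  have i2 : Integrable (fun y : ℝ => h₂ x / 2 * y ^ 2) (gaussianReal 0 t) := by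
    have := integrable_abs_pow_gaussianReal t 2
    simp only [sq_abs] at this
    exact this.const_mul _
  have i01 : Integrable (fun y => h₀ (x + y) - h₀ x) (gaussianReal 0 t) :=
    i0.sub (integrable_const _)
  have i012 : Integrable (fun y => h₀ (x + y) - h₀ x - h₁ x * y) (gaussianReal 0 t) := i01.sub i1
  have key := norm_integral_le_of_norm_le
    (f := fun y => h₀ (x + y) - h₀ x - h₁ x * y - h₂ x / 2 * y ^ 2)
    ((integrable_abs_pow_gaussianReal t 3).const_mul M₃) (ae_of_all _ (h.taylor₀ x))
  rw [integral_sub i012 i2, integral_sub i01 i1, integral_sub i0 (integrable_const _),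
    integral_const_mul, integral_const_mul, integral_const_mul, integral_sq_gaussianReal,
    integral_id_gaussianReal, integral_abs_cube_gaussianReal] at key
  have hs : √(t : ℝ) ^ 3 ≤ t + t ^ 2 := by
    have h1 : (t : ℝ) = √(t : ℝ) ^ 2 := (Real.sq_sqrt t.2).symm
    have h2 := Real.sqrt_nonneg (t : ℝ)
    set s := √(t : ℝ)
    rw [h1]
    nlinarith [sq_nonneg (s * (s - 1)), sq_nonneg s]
  have h3 : 0 ≤ ∫ y, |y| ^ 3 ∂gaussianReal 0 1 := integral_nonneg fun y => by positivity
  calc |_root_.heat t h₀ x - h₀ x - t / 2 * h₂ x| = _ := by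
        rw [← Real.norm_eq_abs]; congr 1; simp [_root_.heat]; ring
    _ ≤ _ := key
    _ ≤ _ := by
        rw [mul_comm (√(t : ℝ) ^ 3)]
        exact mul_le_mul_of_nonneg_left (mul_le_mul_of_nonneg_left hs h3) h.M₃_nonneg

end IsTestFunction

/-- The constant of the second order expansion of the heat semigroup in time. -/
noncomputable def heatConst : ℝ := (∫ y, |y| ^ 3 ∂gaussianReal 0 1) + 1

lemma one_le_heatConst : 1 ≤ heatConst := by
  have h3 : 0 ≤ ∫ y, |y| ^ 3 ∂gaussianReal 0 1 := integral_nonneg fun y => by positivity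
  unfold heatConst
  linarith

/-- By the semigroup property the longer time is the shorter one plus `r`, which reduces to an
expansion at time `r`. Both orders of `s` and `t` occur, since variance increments have no sign. The
second derivative is taken at time `t` because the Lindeberg step in space uses the test function at
the new time; when `s ≤ t` this costs an extra comparison of `heat t h₂` with `heat s h₂`. -/
lemma IsTestFunction.abs_heat_sub_heat_sub_le {h₀ h₁ h₂ : ℝ → ℝ} {B M₂ M₃ : ℝ}
    (h : IsTestFunction h₀ h₁ h₂ B M₂ M₃) (s t : ℝ≥0) (x : ℝ) :
    |_root_.heat t h₀ x - _root_.heat s h₀ x - ((t : ℝ) - s) / 2 * _root_.heat t h₂ x| ≤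
      M₃ * heatConst * (|(t : ℝ) - s| + |(t : ℝ) - s| ^ 2) := by
  have hM := h.M₃_nonneg
  rcases le_total s t with hst | hst
  · obtain ⟨r, rfl⟩ := exists_add_of_le hst
    have e1 := (h.heat s).abs_heat_sub_sub_le r x
    have e2 := abs_heat_sub_le r (h.heat s).continuous₂ (h.heat s).bound₂ hM (h.heat s).lipschitz x
    rw [← heat_add _ _ h.continuous₀ h.bound₀] at e1
    rw [← heat_add _ _ h.continuous₂ h.bound₂] at e2
    have hr : (0 : ℝ) ≤ r := r.2
    rw [NNReal.coe_add, add_sub_cancel_left, abs_of_nonneg hr]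
    have e3 : |(r : ℝ) / 2 * (_root_.heat (s + r) h₂ x - _root_.heat s h₂ x)| ≤
        r / 2 * (M₃ * (1 + r)) := by
      rw [abs_mul, abs_of_nonneg (by positivity)]
      exact mul_le_mul_of_nonneg_left e2 (by positivity)
    have e4 : 0 ≤ r * (M₃ * (1 + r)) := by positivity
    rw [abs_le] at e1 e3 ⊢
    unfold heatConst
    constructor <;> nlinarith
  · obtain ⟨r, rfl⟩ := exists_add_of_le hst
    have e1 := (h.heat t).abs_heat_sub_sub_le r x
    rw [← heat_add _ _ h.continuous₀ h.bound₀] at e1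
    have hr : (0 : ℝ) ≤ r := r.2
    rw [NNReal.coe_add, sub_add_cancel_left, abs_neg, abs_of_nonneg hr]
    have e4 : 0 ≤ r * (M₃ * (1 + r)) := by positivity
    rw [abs_le] at e1 ⊢
    unfold heatConst
    constructor <;> nlinarith

/-! ### Bounded measurable functions, for integrability -/

/-- Bounded measurable real functions. -/
structure IsBoundedMeasurable {Ω : Type*} [MeasurableSpace Ω] (F : Ω → ℝ) : Prop where
  measurable : Measurable F
  bounded : ∃ B, ∀ ω, |F ω| ≤ B

namespace IsBoundedMeasurable

variable {Ω : Type*} [MeasurableSpace Ω] {F G : Ω → ℝ}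

lemma const (c : ℝ) : IsBoundedMeasurable fun _ : Ω => c := ⟨measurable_const, |c|, fun _ => le_rfl⟩

lemma add (hF : IsBoundedMeasurable F) (hG : IsBoundedMeasurable G) :
    IsBoundedMeasurable fun ω => F ω + G ω := by
  obtain ⟨A, hA⟩ := hF.bounded
  obtain ⟨B, hB⟩ := hG.bounded
  exact ⟨hF.measurable.add hG.measurable, A + B, fun ω =>
    (abs_add_le _ _).trans (add_le_add (hA ω) (hB ω))⟩

lemma mul (hF : IsBoundedMeasurable F) (hG : IsBoundedMeasurable G) :
    IsBoundedMeasurable fun ω => F ω * G ω := by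
  obtain ⟨A, hA⟩ := hF.bounded
  obtain ⟨B, hB⟩ := hG.bounded
  refine ⟨hF.measurable.mul hG.measurable, A * B, fun ω => ?_⟩
  rw [abs_mul]
  exact mul_le_mul (hA ω) (hB ω) (abs_nonneg _) ((abs_nonneg _).trans (hA ω))

lemma sub (hF : IsBoundedMeasurable F) (hG : IsBoundedMeasurable G) :
    IsBoundedMeasurable fun ω => F ω - G ω := by
  simpa [sub_eq_add_neg] using hF.add ((const (-1)).mul hG)

lemma pow (hF : IsBoundedMeasurable F) (k : ℕ) : IsBoundedMeasurable fun ω => F ω ^ k := by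
  induction k with
  | zero => simpa using const 1
  | succ k ih => simpa [pow_succ] using ih.mul hF

lemma sum {ι : Type*} {F : ι → Ω → ℝ} {s : Finset ι} (hF : ∀ i, IsBoundedMeasurable (F i)) :
    IsBoundedMeasurable fun ω => ∑ i ∈ s, F i ω := by
  classical
  induction s using Finset.induction_on with
  | empty => simpa using const 0
  | insert a s ha ih => simpa [Finset.sum_insert ha] using (hF a).add ih

lemma comp (hF : IsBoundedMeasurable F) {g : ℝ → ℝ} (hg : Continuous g) :
    IsBoundedMeasurable fun ω => g (F ω) := by
  obtain ⟨A, hA⟩ := hF.bounded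
  obtain ⟨B, hB⟩ := (isCompact_Icc (a := -A) (b := A)).exists_bound_of_continuousOn hg.continuousOn
  exact ⟨hg.measurable.comp hF.measurable, B, fun ω => hB _ (abs_le.1 (hA ω))⟩

lemma integrable {P : Measure Ω} [IsFiniteMeasure P] (hF : IsBoundedMeasurable F) :
    Integrable F P := by
  obtain ⟨A, hA⟩ := hF.bounded
  exact Integrable.of_bound hF.measurable.aestronglyMeasurable A (ae_of_all _ hA)

end IsBoundedMeasurable

/-! ### Weak dependence and second moments of partial sums -/

/-- The sum of the first `k` functions of a sequence. -/
def partialSum {Ω : Type*} (f : ℕ → Ω → ℝ) (k : ℕ) (ω : Ω) : ℝ := ∑ i ∈ Finset.range k, f i ω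

/-- The functions `f 0, …, f (n - 1)` are bounded by one, and each of them, as well as each product
of two of them, is nearly uncorrelated with Lipschitz functions of the partial sums that end at
least `L` indices earlier. -/
structure IsWeaklyDependent {Ω : Type*} [MeasurableSpace Ω] (P : Measure Ω) (f : ℕ → Ω → ℝ)
    (n L : ℕ) (η : ℝ) : Prop where
  measurable : ∀ k, Measurable (f k)
  abs_le_one : ∀ k ω, |f k ω| ≤ 1
  decorrelation₁ : ∀ (g : ℝ → ℝ) (M : ℝ≥0), LipschitzWith M g → ∀ k < n, ∀ j ≤ k - L,
    |∫ ω, g (partialSum f j ω) * f k ω ∂P| ≤ M * η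
  decorrelation₂ : ∀ (g : ℝ → ℝ) (M : ℝ≥0), LipschitzWith M g → ∀ k < n, ∀ m ≤ k, ∀ j ≤ m - L,
    |∫ ω, g (partialSum f j ω) * (f m ω * f k ω) ∂P -
      (∫ ω, g (partialSum f j ω) ∂P) * ∫ ω, f m ω * f k ω ∂P| ≤ M * η

lemma abs_integral_le_of_abs_le {Ω : Type*} [MeasurableSpace Ω] {P : Measure Ω}
    [IsProbabilityMeasure P] {F : Ω → ℝ} {B : ℝ} (hB : ∀ ω, |F ω| ≤ B) : |∫ ω, F ω ∂P| ≤ B := by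
  simpa using norm_integral_le_of_norm_le_const (μ := P) (f := F) (ae_of_all _ hB)

namespace IsWeaklyDependent

variable {Ω : Type*} [MeasurableSpace Ω] {P : Measure Ω} {f : ℕ → Ω → ℝ}
  {n L : ℕ} {η : ℝ}

lemma boundedMeasurable (hf : IsWeaklyDependent P f n L η) (k : ℕ) : IsBoundedMeasurable (f k) :=
  ⟨hf.measurable k, 1, hf.abs_le_one k⟩

lemma boundedMeasurable_partialSum (hf : IsWeaklyDependent P f n L η) (k : ℕ) :
    IsBoundedMeasurable (partialSum f k) :=
  .sum hf.boundedMeasurable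

lemma abs_partialSum_sub_le (hf : IsWeaklyDependent P f n L η) {j k : ℕ} (hjk : j ≤ k) (ω : Ω) :
    |partialSum f k ω - partialSum f j ω| ≤ (k - j : ℕ) := by
  rw [partialSum, partialSum, ← Finset.sum_Ico_eq_sub _ hjk]
  refine (Finset.abs_sum_le_sum_abs _ _).trans ?_
  refine (Finset.sum_le_sum fun i _ => hf.abs_le_one i ω).trans_eq ?_
  simp

lemma eta_nonneg (hf : IsWeaklyDependent P f n L η) (hn : 0 < n) : 0 ≤ η := by
  simpa using (abs_nonneg _).trans (hf.decorrelation₁ id 1 LipschitzWith.id 0 hn 0 (Nat.zero_le _))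

lemma abs_integral_partialSum_mul_le (hf : IsWeaklyDependent P f n L η) {k j : ℕ} (hk : k < n)
    (hj : j ≤ k - L) : |∫ ω, partialSum f j ω * f k ω ∂P| ≤ η := by
  simpa using hf.decorrelation₁ id 1 LipschitzWith.id k hk j hj

variable [IsProbabilityMeasure P]

/-- Only the terms of `partialSum f k` within distance `L` of `m` can correlate with `f m`: there
are at most `L` of them, and none if `m ≥ k + L`. The rest contributes `η`. -/
lemma abs_integral_partialSum_mul_le_add (hf : IsWeaklyDependent P f n L η) {k m : ℕ} (hm : m < n)
    (hk : k ≤ m) :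
    |∫ ω, partialSum f k ω * f m ω ∂P| ≤ (if m < k + L then (L : ℝ) else 0) + η := by
  set j := min k (m - L) with hj
  have hjk : j ≤ k := min_le_left _ _
  have hS := hf.boundedMeasurable_partialSum
  have hb := hf.boundedMeasurable
  have e : ∫ ω, partialSum f k ω * f m ω ∂P =
      ∫ ω, (partialSum f k ω - partialSum f j ω) * f m ω ∂P +
        ∫ ω, partialSum f j ω * f m ω ∂P := by
    rw [← integral_add (((hS k).sub (hS j)).mul (hb m)).integrable ((hS j).mul (hb m)).integrable]
    congr with ω
    ring
  rw [e]
  refine (abs_add_le _ _).trans (add_le_add ?_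
    (hf.abs_integral_partialSum_mul_le hm (min_le_right _ _)))
  refine abs_integral_le_of_abs_le fun ω => ?_
  rw [abs_mul]
  refine (mul_le_of_le_one_right (abs_nonneg _) (hf.abs_le_one m ω)).trans ?_
  refine (hf.abs_partialSum_sub_le hjk ω).trans ?_
  split_ifs with h
  · exact_mod_cast (by omega : k - j ≤ L)
  · exact_mod_cast (by omega : k - j ≤ 0)

lemma integral_partialSum_succ_sq (hf : IsWeaklyDependent P f n L η) (k : ℕ) :
    ∫ ω, partialSum f (k + 1) ω ^ 2 ∂P = ∫ ω, partialSum f k ω ^ 2 ∂P +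
      (2 * ∫ ω, partialSum f k ω * f k ω ∂P + ∫ ω, f k ω * f k ω ∂P) := by
  have hS := hf.boundedMeasurable_partialSum
  have hb := hf.boundedMeasurable
  rw [← integral_const_mul, ← integral_add (((IsBoundedMeasurable.const 2).mul
      ((hS k).mul (hb k)))).integrable ((hb k).mul (hb k)).integrable,
    ← integral_add ((hS k).pow 2).integrable (((IsBoundedMeasurable.const 2).mul
      ((hS k).mul (hb k))).add ((hb k).mul (hb k))).integrable]
  congr with ω
  rw [partialSum, Finset.sum_range_succ]
  simp only [partialSum]
  ring

/-- The variances of the partial sums are increasing up to a bounded error. -/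
lemma integral_partialSum_sq_le (hf : IsWeaklyDependent P f n L η) (hn : 0 < n) (hL : 1 ≤ L)
    (hη : n * η ≤ 1) {k : ℕ} (hk : k ≤ n) :
    ∫ ω, partialSum f k ω ^ 2 ∂P ≤ ∫ ω, partialSum f n ω ^ 2 ∂P + 4 * (L : ℝ) ^ 2 := by
  have hS := hf.boundedMeasurable_partialSum
  have hb := hf.boundedMeasurable
  have hL1 : (1 : ℝ) ≤ L := by exact_mod_cast hL
  have hη0 := hf.eta_nonneg hn
  have h1 : ∫ ω, partialSum f k ω * (partialSum f n ω - partialSum f k ω) ∂P =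
      ∑ m ∈ Finset.Ico k n, ∫ ω, partialSum f k ω * f m ω ∂P := by
    rw [← integral_finsetSum _ fun m _ => ((hS k).mul (hb m)).integrable]
    congr with ω
    rw [← Finset.mul_sum, Finset.sum_Ico_eq_sub _ hk]
    rfl
  -- At most `L` indices `m` lie within the gap after `k`, each costing `L`; the errors `η` sum to
  -- at most `n * η ≤ 1`.
  have h2 : |∫ ω, partialSum f k ω * (partialSum f n ω - partialSum f k ω) ∂P| ≤
      (L : ℝ) ^ 2 + 1 := by
    rw [h1]
    refine (Finset.abs_sum_le_sum_abs _ _).trans ((Finset.sum_le_sum fun m hm =>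
      hf.abs_integral_partialSum_mul_le_add (Finset.mem_Ico.1 hm).2
        (Finset.mem_Ico.1 hm).1).trans ?_)
    rw [Finset.sum_add_distrib, ← Finset.sum_filter, Finset.sum_const, Finset.sum_const,
      nsmul_eq_mul, nsmul_eq_mul, sq]
    refine add_le_add (mul_le_mul_of_nonneg_right ?_ (by positivity)) ?_
    · have : (Finset.Ico k n).filter (· < k + L) ⊆ Finset.Ico k (k + L) := by
        intro m
        simp only [Finset.mem_filter, Finset.mem_Ico]
        omega
      have := Finset.card_le_card this
      rw [Nat.card_Ico, Nat.add_sub_cancel_left] at this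
      exact_mod_cast this
    · refine (mul_le_mul_of_nonneg_right ?_ hη0).trans hη
      rw [Nat.card_Ico]
      exact_mod_cast Nat.sub_le _ _
  have h3 : ∫ ω, partialSum f n ω ^ 2 ∂P = ∫ ω, partialSum f k ω ^ 2 ∂P +
      (2 * ∫ ω, partialSum f k ω * (partialSum f n ω - partialSum f k ω) ∂P +
        ∫ ω, (partialSum f n ω - partialSum f k ω) ^ 2 ∂P) := by
    have hD := (hS n).sub (hS k)
    rw [← integral_const_mul, ← integral_add (((IsBoundedMeasurable.const 2).mul
        ((hS k).mul hD))).integrable (hD.pow 2).integrable,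
      ← integral_add ((hS k).pow 2).integrable (((IsBoundedMeasurable.const 2).mul
        ((hS k).mul hD)).add (hD.pow 2)).integrable]
    congr with ω
    ring
  have h4 : 0 ≤ ∫ ω, (partialSum f n ω - partialSum f k ω) ^ 2 ∂P :=
    integral_nonneg fun ω => sq_nonneg _
  have h5 := (abs_le.1 h2).1
  nlinarith

lemma abs_integral_sq_sub_le (hf : IsWeaklyDependent P f n L η) (hL : 1 ≤ L) (hη : η ≤ 1) {k : ℕ}
    (hk : k < n) :
    |∫ ω, partialSum f (k + 1) ω ^ 2 ∂P - ∫ ω, partialSum f k ω ^ 2 ∂P| ≤ 5 * L := by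
  have hL1 : (1 : ℝ) ≤ L := by exact_mod_cast hL
  have h1 := hf.abs_integral_partialSum_mul_le_add hk le_rfl
  rw [if_pos (by omega)] at h1
  have h2 : |∫ ω, f k ω * f k ω ∂P| ≤ 1 := abs_integral_le_of_abs_le fun ω => by
    rw [abs_mul]
    exact mul_le_one₀ (hf.abs_le_one k ω) (abs_nonneg _) (hf.abs_le_one k ω)
  rw [hf.integral_partialSum_succ_sq, add_sub_cancel_left]
  rw [abs_le] at h1 h2 ⊢
  constructor <;> linarith

end IsWeaklyDependent

/-! ### Lindeberg telescoping along the heat flow -/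

namespace IsWeaklyDependent

variable {Ω : Type*} [MeasurableSpace Ω] {P : Measure Ω} {f : ℕ → Ω → ℝ}
  {n L : ℕ} {η : ℝ} [IsProbabilityMeasure P]

/-- One step of the Lindeberg telescoping: the first order term. -/
lemma abs_integral_deriv_mul_sub_le (hf : IsWeaklyDependent P f n L η) (hη : η ≤ 1)
    {g₀ g₁ g₂ : ℝ → ℝ} {B M₂ M₃ : ℝ} (hg : IsTestFunction g₀ g₁ g₂ B M₂ M₃) {k : ℕ} (hk : k < n) :
    |∫ ω, g₁ (partialSum f k ω) * f k ω ∂P -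
      (∫ ω, g₂ (partialSum f (k - 2 * L) ω) ∂P) * ∫ ω, partialSum f k ω * f k ω ∂P| ≤
      2 * (L : ℝ) ^ 2 * M₃ + L * M₃ + 2 * M₂ * η := by
  have hS := hf.boundedMeasurable_partialSum
  have hb := hf.boundedMeasurable
  have hM₂ := hg.M₂_nonneg
  have hM₃ := hg.M₃_nonneg
  have hη0 := hf.eta_nonneg (Nat.zero_lt_of_lt hk)
  -- Two successive gaps: `S j` is decorrelated from `f k`, and `S i` from every product `f m * f k`
  -- with `j ≤ m`. Truncated subtraction is harmless, since the empty sum is a constant.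
  set j := k - L with hj
  set i := k - 2 * L with hi
  have hij : i ≤ j := by omega
  have hjk : j ≤ k := by omega
  have hS1 (l : ℕ) := (hS l).comp hg.continuous₁
  have hS2 (l : ℕ) := (hS l).comp hg.continuous₂
  have hkj : ∀ ω, |partialSum f k ω - partialSum f j ω| ≤ L := fun ω =>
    (hf.abs_partialSum_sub_le hjk ω).trans (by exact_mod_cast (by omega : k - j ≤ L))
  have hji : ∀ ω, |partialSum f j ω - partialSum f i ω| ≤ L := fun ω =>
    (hf.abs_partialSum_sub_le hij ω).trans (by exact_mod_cast (by omega : j - i ≤ L))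
  set G := ∫ ω, g₂ (partialSum f i ω) ∂P with hG
  have hGle : |G| ≤ M₂ := abs_integral_le_of_abs_le fun ω => hg.bound₂ _
  -- linearization of `g₁`
  have e1 : |∫ ω, (g₁ (partialSum f k ω) - g₁ (partialSum f j ω) -
      g₂ (partialSum f i ω) * (partialSum f k ω - partialSum f j ω)) * f k ω ∂P| ≤
      2 * (L : ℝ) ^ 2 * M₃ := by
    refine abs_integral_le_of_abs_le fun ω => ?_
    rw [abs_mul]
    refine (mul_le_of_le_one_right (abs_nonneg _) (hf.abs_le_one k ω)).trans ?_
    have t1 := hg.taylor₁ (partialSum f j ω) (partialSum f k ω - partialSum f j ω)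
    rw [add_sub_cancel] at t1
    have t2 : |(g₂ (partialSum f j ω) - g₂ (partialSum f i ω)) *
        (partialSum f k ω - partialSum f j ω)| ≤ M₃ * L * L := by
      rw [abs_mul]
      exact mul_le_mul ((hg.lipschitz _ _).trans (mul_le_mul_of_nonneg_left (hji ω) hM₃)) (hkj ω)
        (abs_nonneg _) (by positivity)
    have t3 : (partialSum f k ω - partialSum f j ω) ^ 2 ≤ (L : ℝ) ^ 2 :=
      sq_le_sq' (abs_le.1 (hkj ω)).1 (abs_le.1 (hkj ω)).2
    have t4 := mul_le_mul_of_nonneg_left t3 hM₃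
    rw [abs_le] at t1 t2 ⊢
    constructor <;> nlinarith
  -- the main term decorrelates
  have e2 := hf.decorrelation₁ g₁ _ hg.lipschitzWith₁ k hk j le_rfl
  rw [Real.coe_toNNReal _ hM₂] at e2
  have e3 : |∫ ω, g₂ (partialSum f i ω) * ((partialSum f k ω - partialSum f j ω) * f k ω) ∂P -
      G * ∫ ω, (partialSum f k ω - partialSum f j ω) * f k ω ∂P| ≤ L * (M₃ * η) := by
    have s1 : ∀ ω, (partialSum f k ω - partialSum f j ω) * f k ω =
        ∑ m ∈ Finset.Ico j k, f m ω * f k ω := fun ω => by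
      rw [← Finset.sum_mul, Finset.sum_Ico_eq_sub _ hjk]
      rfl
    simp only [s1, Finset.mul_sum]
    rw [integral_finsetSum _ fun m _ => ((hS2 i).mul ((hb m).mul (hb k))).integrable,
      integral_finsetSum _ fun m _ => ((hb m).mul (hb k)).integrable, Finset.mul_sum,
      ← Finset.sum_sub_distrib]
    refine (Finset.abs_sum_le_sum_abs _ _).trans ((Finset.sum_le_card_nsmul _ _ (M₃ * η)
      fun m hm => ?_).trans ?_)
    · have hm := Finset.mem_Ico.1 hm
      have := hf.decorrelation₂ g₂ _ hg.lipschitzWith₂ k hk m hm.2.le i (by omega)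
      rwa [Real.coe_toNNReal _ hM₃] at this
    · rw [nsmul_eq_mul, Nat.card_Ico]
      exact mul_le_mul_of_nonneg_right (by exact_mod_cast (by omega : k - j ≤ L)) (by positivity)
  -- This restores the early part of the sum, so that the main term contains the full `E (S k * f
  -- k)` occurring in the variance increment.
  have e4 : |G * ∫ ω, partialSum f j ω * f k ω ∂P| ≤ M₂ * η := by
    rw [abs_mul]
    exact mul_le_mul hGle (hf.abs_integral_partialSum_mul_le hk le_rfl) (abs_nonneg _) hM₂
  have d1 : ∫ ω, (partialSum f k ω - partialSum f j ω) * f k ω ∂P =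
      ∫ ω, partialSum f k ω * f k ω ∂P - ∫ ω, partialSum f j ω * f k ω ∂P := by
    rw [← integral_sub ((hS k).mul (hb k)).integrable ((hS j).mul (hb k)).integrable]
    simp only [sub_mul]
  have d2 : ∫ ω, (g₁ (partialSum f k ω) - g₁ (partialSum f j ω) -
      g₂ (partialSum f i ω) * (partialSum f k ω - partialSum f j ω)) * f k ω ∂P =
      ∫ ω, g₁ (partialSum f k ω) * f k ω ∂P - ∫ ω, g₁ (partialSum f j ω) * f k ω ∂P -
      ∫ ω, g₂ (partialSum f i ω) * ((partialSum f k ω - partialSum f j ω) * f k ω) ∂P := by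
    rw [← integral_sub ((hS1 k).mul (hb k)).integrable ((hS1 j).mul (hb k)).integrable,
      ← integral_sub (((hS1 k).mul (hb k)).sub ((hS1 j).mul (hb k))).integrable
        ((hS2 i).mul (((hS k).sub (hS j)).mul (hb k))).integrable]
    congr with ω
    ring
  rw [d2] at e1
  rw [d1] at e3
  have e5 : L * (M₃ * η) ≤ L * M₃ := by
    rw [← mul_assoc]
    exact mul_le_of_le_one_right (by positivity) hη
  rw [abs_le] at *
  constructor <;> linarith

/-- One step of the Lindeberg telescoping: the second order term. -/
lemma abs_integral_deriv_mul_sq_sub_le (hf : IsWeaklyDependent P f n L η) (hη : η ≤ 1)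
    {g₀ g₁ g₂ : ℝ → ℝ} {B M₂ M₃ : ℝ} (hg : IsTestFunction g₀ g₁ g₂ B M₂ M₃) {k : ℕ} (hk : k < n) :
    |∫ ω, g₂ (partialSum f k ω) * (f k ω * f k ω) ∂P -
      (∫ ω, g₂ (partialSum f (k - 2 * L) ω) ∂P) * ∫ ω, f k ω * f k ω ∂P| ≤
      2 * L * M₃ + M₃ := by
  have hS := hf.boundedMeasurable_partialSum
  have hb := hf.boundedMeasurable
  have hM₃ := hg.M₃_nonneg
  have hS2 (l : ℕ) := (hS l).comp hg.continuous₂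
  set i := k - 2 * L with hi
  have e1 : |∫ ω, (g₂ (partialSum f k ω) - g₂ (partialSum f i ω)) * (f k ω * f k ω) ∂P| ≤
      2 * L * M₃ := by
    refine abs_integral_le_of_abs_le fun ω => ?_
    have h1 : |f k ω * f k ω| ≤ 1 := by
      rw [abs_mul]
      exact mul_le_one₀ (hf.abs_le_one k ω) (abs_nonneg _) (hf.abs_le_one k ω)
    rw [abs_mul]
    refine (mul_le_of_le_one_right (abs_nonneg _) h1).trans ((hg.lipschitz _ _).trans ?_)
    rw [mul_comm]
    refine mul_le_mul_of_nonneg_right ((hf.abs_partialSum_sub_le (by omega) ω).trans ?_) hM₃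
    exact_mod_cast (by omega : k - i ≤ 2 * L)
  have e2 := hf.decorrelation₂ g₂ _ hg.lipschitzWith₂ k hk k le_rfl i (by omega)
  rw [Real.coe_toNNReal _ hM₃] at e2
  have e3 : M₃ * η ≤ M₃ := mul_le_of_le_one_right hM₃ hη
  have d1 : ∫ ω, (g₂ (partialSum f k ω) - g₂ (partialSum f i ω)) * (f k ω * f k ω) ∂P =
      ∫ ω, g₂ (partialSum f k ω) * (f k ω * f k ω) ∂P -
        ∫ ω, g₂ (partialSum f i ω) * (f k ω * f k ω) ∂P := by
    rw [← integral_sub ((hS2 k).mul ((hb k).mul (hb k))).integrable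
      ((hS2 i).mul ((hb k).mul (hb k))).integrable]
    simp only [sub_mul]
  rw [d1] at e1
  rw [abs_le] at *
  constructor <;> linarith

/-- The first and second order terms share the factor `E g₂ (S i)`, and their coefficients `E (S k *
f k)` and `E (f k ^ 2) / 2` add up to half the variance increment. Replacing `S i` by `S k` then
costs at most `5 / 2 * L` times `2 * L * M₃`. -/
lemma abs_integral_succ_sub_le (hf : IsWeaklyDependent P f n L η) (hL : 1 ≤ L) (hη : η ≤ 1)
    {g₀ g₁ g₂ : ℝ → ℝ} {B M₂ M₃ : ℝ} (hg : IsTestFunction g₀ g₁ g₂ B M₂ M₃) {k : ℕ} (hk : k < n) :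
    |∫ ω, g₀ (partialSum f (k + 1) ω) ∂P - ∫ ω, g₀ (partialSum f k ω) ∂P -
      (∫ ω, partialSum f (k + 1) ω ^ 2 ∂P - ∫ ω, partialSum f k ω ^ 2 ∂P) / 2 *
        ∫ ω, g₂ (partialSum f k ω) ∂P| ≤ 12 * (L : ℝ) ^ 2 * M₃ + 2 * M₂ * η := by
  have hL1 : (1 : ℝ) ≤ L := by exact_mod_cast hL
  have hS := hf.boundedMeasurable_partialSum
  have hb := hf.boundedMeasurable
  have hM₃ := hg.M₃_nonneg
  have hS0 (l : ℕ) := (hS l).comp hg.continuous₀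
  have hS1 (l : ℕ) := (hS l).comp hg.continuous₁
  have hS2 (l : ℕ) := (hS l).comp hg.continuous₂
  have e1 := hf.abs_integral_deriv_mul_sub_le hη hg hk
  have e2 := hf.abs_integral_deriv_mul_sq_sub_le hη hg hk
  set i := k - 2 * L with hi
  have e3 : |∫ ω, (g₀ (partialSum f (k + 1) ω) - g₀ (partialSum f k ω) -
      g₁ (partialSum f k ω) * f k ω - 1 / 2 * (g₂ (partialSum f k ω) * (f k ω * f k ω))) ∂P| ≤
      M₃ := by
    refine abs_integral_le_of_abs_le fun ω => ?_
    have h1 : partialSum f (k + 1) ω = partialSum f k ω + f k ω := Finset.sum_range_succ _ _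
    calc _ = |g₀ (partialSum f k ω + f k ω) - g₀ (partialSum f k ω) -
        g₁ (partialSum f k ω) * f k ω - g₂ (partialSum f k ω) / 2 * f k ω ^ 2| := by
          rw [h1]; congr 1; ring
      _ ≤ M₃ * |f k ω| ^ 3 := hg.taylor₀ _ _
      _ ≤ M₃ := mul_le_of_le_one_right hM₃ (pow_le_one₀ (abs_nonneg _) (hf.abs_le_one k ω))
  rw [integral_sub (((hS0 _).sub (hS0 _)).sub ((hS1 k).mul (hb k))).integrable
      ((IsBoundedMeasurable.const (1 / 2)).mul ((hS2 k).mul ((hb k).mul (hb k)))).integrable,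
    integral_sub ((hS0 _).sub (hS0 _)).integrable ((hS1 k).mul (hb k)).integrable,
    integral_sub (hS0 _).integrable (hS0 _).integrable, integral_const_mul] at e3
  have e4 : |(∫ ω, partialSum f (k + 1) ω ^ 2 ∂P - ∫ ω, partialSum f k ω ^ 2 ∂P) / 2 *
      (∫ ω, g₂ (partialSum f k ω) ∂P - ∫ ω, g₂ (partialSum f i ω) ∂P)| ≤
      5 / 2 * L * (2 * L * M₃) := by
    rw [abs_mul]
    refine mul_le_mul ?_ ?_ (abs_nonneg _) (by positivity)
    · rw [abs_div, abs_two]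
      linarith [hf.abs_integral_sq_sub_le hL hη hk]
    · rw [← integral_sub (hS2 k).integrable (hS2 i).integrable]
      refine abs_integral_le_of_abs_le fun ω => (hg.lipschitz _ _).trans ?_
      rw [mul_comm]
      refine mul_le_mul_of_nonneg_right ((hf.abs_partialSum_sub_le (by omega) ω).trans ?_) hM₃
      exact_mod_cast (by omega : k - i ≤ 2 * L)
  have h1 : L * M₃ ≤ (L : ℝ) ^ 2 * M₃ := mul_le_mul_of_nonneg_right (by nlinarith) hM₃
  have h2 : M₃ ≤ (L : ℝ) ^ 2 * M₃ := le_mul_of_one_le_left hM₃ (by nlinarith)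
  rw [hf.integral_partialSum_succ_sq, add_sub_cancel_left] at *
  rw [abs_le] at *
  constructor <;> linarith

/-- Quantitative central limit theorem for smooth test functions. -/
lemma abs_integral_sub_heat_le (hf : IsWeaklyDependent P f n L η) (hn : 0 < n) (hL : 1 ≤ L)
    (hη : n * η ≤ 1) {h₀ h₁ h₂ : ℝ → ℝ} {B M₂ M₃ : ℝ} (hh : IsTestFunction h₀ h₁ h₂ B M₂ M₃) :
    |∫ ω, h₀ (partialSum f n ω) ∂P - heat (∫ ω, partialSum f n ω ^ 2 ∂P).toNNReal h₀ 0| ≤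
      n * (42 * heatConst * (L : ℝ) ^ 2 * M₃ + 2 * M₂ * η) +
        (4 * (L : ℝ) ^ 2 * M₂ + 40 * heatConst * (L : ℝ) ^ 4 * M₃) := by
  have hL1 : (1 : ℝ) ≤ L := by exact_mod_cast hL
  have hn1 : (1 : ℝ) ≤ n := by exact_mod_cast hn
  have hM₂ := hh.M₂_nonneg
  have hM₃ := hh.M₃_nonneg
  have hc := one_le_heatConst
  have hη0 := hf.eta_nonneg hn
  have hη1 : η ≤ 1 := by nlinarith
  have hS := hf.boundedMeasurable_partialSum
  set V : ℕ → ℝ := fun k => ∫ ω, partialSum f k ω ^ 2 ∂P with hV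
  have hVn : 0 ≤ V n := integral_nonneg fun ω => sq_nonneg _
  -- The remaining variance `V n - V k` may be slightly negative; the shift `4 * L ^ 2` is the
  -- defect of monotonicity of the variances, and keeps all times nonnegative.
  set t : ℕ → ℝ≥0 := fun k => (V n - V k + 4 * (L : ℝ) ^ 2).toNNReal with ht
  have htk (k : ℕ) (hk : k ≤ n) : (t k : ℝ) = V n - V k + 4 * (L : ℝ) ^ 2 :=
    Real.coe_toNNReal _ (by linarith [hf.integral_partialSum_sq_le hn hL hη hk])
  set A : ℕ → ℝ := fun k => ∫ ω, heat (t k) h₀ (partialSum f k ω) ∂P with hA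
  have hstep (k : ℕ) (hk : k < n) :
      |A (k + 1) - A k| ≤ 42 * heatConst * (L : ℝ) ^ 2 * M₃ + 2 * M₂ * η := by
    have hg := hh.heat (t (k + 1))
    have e1 := hf.abs_integral_succ_sub_le hL hη1 hg hk
    have hS0 (s : ℝ≥0) (l : ℕ) := (hS l).comp (hh.heat s).continuous₀
    have hS2 := (hS k).comp hg.continuous₂
    -- Change of time at fixed `S k`. As `t (k + 1) - t k` is minus the variance increment, its main
    -- term cancels that of `e1`.
    have e2 : |∫ ω, (heat (t (k + 1)) h₀ (partialSum f k ω) - heat (t k) h₀ (partialSum f k ω) -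
        ((t (k + 1) : ℝ) - t k) / 2 * heat (t (k + 1)) h₂ (partialSum f k ω)) ∂P| ≤
        M₃ * heatConst * (|(t (k + 1) : ℝ) - t k| + |(t (k + 1) : ℝ) - t k| ^ 2) :=
      abs_integral_le_of_abs_le fun ω => hh.abs_heat_sub_heat_sub_le (t k) (t (k + 1)) _
    rw [integral_sub ((hS0 _ _).sub (hS0 _ _)).integrable
        ((IsBoundedMeasurable.const _).mul hS2).integrable,
      integral_sub (hS0 _ _).integrable (hS0 _ _).integrable, integral_const_mul] at e2
    have e3 : (t (k + 1) : ℝ) - t k = -(V (k + 1) - V k) := by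
      rw [htk _ hk, htk _ hk.le]
      ring
    rw [e3, abs_neg] at e2
    have e4 : |V (k + 1) - V k| ≤ 5 * L := hf.abs_integral_sq_sub_le hL hη1 hk
    have e5 : |V (k + 1) - V k| + |V (k + 1) - V k| ^ 2 ≤ 30 * (L : ℝ) ^ 2 := by
      have := pow_le_pow_left₀ (abs_nonneg _) e4 2
      nlinarith
    have e6 : M₃ * heatConst * (|V (k + 1) - V k| + |V (k + 1) - V k| ^ 2) ≤
        M₃ * heatConst * (30 * (L : ℝ) ^ 2) := mul_le_mul_of_nonneg_left e5 (by positivity)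
    have e7 : (L : ℝ) ^ 2 * M₃ ≤ heatConst * ((L : ℝ) ^ 2 * M₃) :=
      le_mul_of_one_le_left (by positivity) hc
    simp only [hA]
    rw [abs_le] at e1 e2 ⊢
    constructor <;> nlinarith
  have htel : |A n - A 0| ≤ n * (42 * heatConst * (L : ℝ) ^ 2 * M₃ + 2 * M₂ * η) := by
    rw [← Finset.sum_range_sub]
    refine (Finset.abs_sum_le_sum_abs _ _).trans ((Finset.sum_le_card_nsmul _ _ _
      fun k hk => hstep k (Finset.mem_range.1 hk)).trans_eq ?_)
    rw [Finset.card_range, nsmul_eq_mul]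
  -- The shift is removed at both ends: at `n` the remaining time is exactly `τ`, at `0` it is `V n`
  -- plus `τ`.
  set τ : ℝ≥0 := (4 * (L : ℝ) ^ 2).toNNReal with hτ
  have hτ' : (τ : ℝ) = 4 * (L : ℝ) ^ 2 := Real.coe_toNNReal _ (by positivity)
  have hsmall {g₀ g₁ g₂ : ℝ → ℝ} (hg : IsTestFunction g₀ g₁ g₂ B M₂ M₃) (x : ℝ) :
      |heat τ g₀ x - g₀ x| ≤ 2 * (L : ℝ) ^ 2 * M₂ + 20 * heatConst * (L : ℝ) ^ 4 * M₃ := by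
    have h1 := hg.abs_heat_sub_sub_le τ x
    have h2 : |(τ : ℝ) / 2 * g₂ x| ≤ 2 * (L : ℝ) ^ 2 * M₂ := by
      rw [abs_mul, abs_of_nonneg (by positivity), hτ']
      exact mul_le_mul (by linarith) (hg.bound₂ x) (abs_nonneg _) (by positivity)
    have h3 : M₃ * ((∫ y, |y| ^ 3 ∂gaussianReal 0 1) * (τ + τ ^ 2)) ≤
        M₃ * (heatConst * (20 * (L : ℝ) ^ 4)) := by
      refine mul_le_mul_of_nonneg_left (mul_le_mul ?_ ?_ (by positivity) (by positivity)) hM₃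
      · unfold heatConst
        linarith
      · rw [hτ']
        nlinarith [pow_le_pow_right₀ hL1 (show 2 ≤ 4 by norm_num)]
    rw [abs_le] at *
    constructor <;> linarith
  have hAn : |A n - ∫ ω, h₀ (partialSum f n ω) ∂P| ≤
      2 * (L : ℝ) ^ 2 * M₂ + 20 * heatConst * (L : ℝ) ^ 4 * M₃ := by
    have : t n = τ := by simp [ht, hτ]
    simp only [hA, this]
    rw [← integral_sub ((hS n).comp (hh.heat τ).continuous₀).integrable
      ((hS n).comp hh.continuous₀).integrable]
    exact abs_integral_le_of_abs_le fun ω => hsmall hh _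
  have hA0 : |A 0 - heat (V n).toNNReal h₀ 0| ≤
      2 * (L : ℝ) ^ 2 * M₂ + 20 * heatConst * (L : ℝ) ^ 4 * M₃ := by
    have h1 : t 0 = (V n).toNNReal + τ := by
      rw [hτ, ← Real.toNNReal_add hVn (by positivity)]
      simp [ht, hV, partialSum]
    have h2 : A 0 = heat τ (heat (V n).toNNReal h₀) 0 := by
      rw [← heat_add _ _ hh.continuous₀ hh.bound₀, ← h1]
      simp [hA, partialSum]
    rw [h2]
    exact hsmall (hh.heat _) 0
  rw [abs_le] at *
  constructor <;> linarith

end IsWeaklyDependent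

/-! ### From smooth test functions to the Kolmogorov distance -/

/-- The powers of the width `a` in the last two bounds drive the final rate. With `1 ≤ a` the bound
`B` survives unchanged; it serves only integrability and differentiation under the integral. -/
lemma IsTestFunction.comp_sub_div {h₀ h₁ h₂ : ℝ → ℝ} {B M₂ M₃ : ℝ}
    (h : IsTestFunction h₀ h₁ h₂ B M₂ M₃) (x : ℝ) {a : ℝ} (ha : 1 ≤ a) :
    IsTestFunction (fun y => h₀ ((y - x) / a)) (fun y => h₁ ((y - x) / a) / a)
      (fun y => h₂ ((y - x) / a) / a ^ 2) B (M₂ / a ^ 2) (M₃ / a ^ 3) := by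
  have ha0 : 0 < a := by linarith
  have hd (y : ℝ) : HasDerivAt (fun y => (y - x) / a) (1 / a) y :=
    ((hasDerivAt_id y).sub_const x).div_const a
  refine ⟨fun y => ?_, fun y => ?_, fun y => h.bound₀ _, fun y => ?_, fun y => ?_, fun y z => ?_⟩
  · exact ((h.deriv₀ _).comp y (hd y)).congr_deriv (by ring)
  · exact (((h.deriv₁ _).comp y (hd y)).div_const a).congr_deriv (by ring)
  · rw [abs_div, abs_of_pos ha0]
    exact (div_le_self (abs_nonneg _) ha).trans (h.bound₁ _)
  · rw [abs_div, abs_of_pos (pow_pos ha0 2)]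
    exact div_le_div_of_nonneg_right (h.bound₂ _) (by positivity)
  · rw [← sub_div, abs_div, abs_of_pos (pow_pos ha0 2)]
    refine (div_le_div_of_nonneg_right (h.lipschitz _ _) (by positivity)).trans_eq ?_
    rw [← sub_div, sub_sub_sub_cancel_right, abs_div, abs_of_pos ha0]
    field_simp

/-- There is a smooth step with bounded derivatives. -/
lemma exists_step_isTestFunction : ∃ (φ φ₁ φ₂ : ℝ → ℝ) (c : ℝ), 0 < c ∧
    IsTestFunction φ φ₁ φ₂ c c c ∧ (∀ x, 0 ≤ φ x) ∧ (∀ x, φ x ≤ 1) ∧ (∀ x ≤ 0, φ x = 1) ∧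
    ∀ x, 1 ≤ x → φ x = 0 := by
  have hs : ContDiff ℝ 3 Real.smoothTransition := Real.smoothTransition.contDiff (n := 3)
  set φ : ℝ → ℝ := fun x => 1 - Real.smoothTransition x with hφ
  have h0 : ContDiff ℝ 3 φ := contDiff_const.sub hs
  have h1 : ContDiff ℝ 2 (deriv φ) := ((contDiff_succ_iff_deriv (n := 2)).1 h0).2.2
  have h2 : ContDiff ℝ 1 (deriv (deriv φ)) := ((contDiff_succ_iff_deriv (n := 1)).1 h1).2.2
  have h3 : ContDiff ℝ 0 (deriv (deriv (deriv φ))) := ((contDiff_succ_iff_deriv (n := 0)).1 h2).2.2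
  have hneg : ∀ x ≤ 0, φ x = 1 := fun x hx => by
    simp [hφ, Real.smoothTransition.zero_of_nonpos hx]
  have hpos : ∀ x, 1 ≤ x → φ x = 0 := fun x hx => by
    simp [hφ, Real.smoothTransition.one_of_one_le hx]
  have c1 : HasCompactSupport (deriv φ) := by
    refine HasCompactSupport.intro (isCompact_Icc (a := (0 : ℝ)) (b := 1)) fun x hx => ?_
    rw [Set.mem_Icc, not_and_or, not_le, not_le] at hx
    rcases hx with hx | hx
    · have : φ =ᶠ[nhds x] fun _ => 1 := by
        filter_upwards [Iio_mem_nhds hx] with y hy using hneg y (le_of_lt hy)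
      rw [this.deriv_eq, deriv_const]
    · have : φ =ᶠ[nhds x] fun _ => 0 := by
        filter_upwards [Ioi_mem_nhds hx] with y hy using hpos y (le_of_lt hy)
      rw [this.deriv_eq, deriv_const]
  obtain ⟨b1, hb1⟩ := h1.continuous.bounded_above_of_compact_support c1
  obtain ⟨b2, hb2⟩ := h2.continuous.bounded_above_of_compact_support c1.deriv
  obtain ⟨b3, hb3⟩ := h3.continuous.bounded_above_of_compact_support c1.deriv.deriv
  have hφ0 : ∀ x, 0 ≤ φ x := fun x => sub_nonneg.2 (Real.smoothTransition.le_one x)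
  have hφ1 : ∀ x, φ x ≤ 1 := fun x => sub_le_self _ (Real.smoothTransition.nonneg x)
  have hb1' := (norm_nonneg _).trans (hb1 0)
  have hb2' := (norm_nonneg _).trans (hb2 0)
  have hb3' := (norm_nonneg _).trans (hb3 0)
  refine ⟨φ, deriv φ, deriv (deriv φ), 1 + b1 + b2 + b3, by positivity,
    ⟨fun x => (h0.differentiable (by norm_num) x).hasDerivAt,
      fun x => (h1.differentiable (by norm_num) x).hasDerivAt, fun x => ?_, fun x => ?_,
      fun x => ?_, fun x y => ?_⟩, hφ0, hφ1, hneg, hpos⟩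
  · rw [abs_of_nonneg (hφ0 x)]
    linarith [hφ1 x]
  · have := hb1 x
    rw [Real.norm_eq_abs] at this
    linarith
  · have := hb2 x
    rw [Real.norm_eq_abs] at this
    linarith
  · refine (Convex.norm_image_sub_le_of_norm_hasDerivWithin_le (s := Set.univ)
      (fun z _ => (h2.differentiable (by norm_num) z).hasDerivAt.hasDerivWithinAt)
      (fun z _ => hb3 z) convex_univ (Set.mem_univ y) (Set.mem_univ x)).trans ?_
    exact mul_le_mul_of_nonneg_right (by linarith) (abs_nonneg _)

/-- The standard Gaussian density is at most `1 / √(2 * π) ≤ 1`. -/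
lemma gaussianReal_Iic_add_le (x : ℝ) {ε : ℝ} (hε : 0 ≤ ε) :
    (gaussianReal 0 1).real (Set.Iic (x + ε)) ≤ (gaussianReal 0 1).real (Set.Iic x) + ε := by
  have h1 : Set.Iic (x + ε) = Set.Iic x ∪ Set.Ioc x (x + ε) :=
    (Set.Iic_union_Ioc_eq_Iic (by linarith)).symm
  have h2 : gaussianReal 0 1 (Set.Ioc x (x + ε)) ≤ ENNReal.ofReal ε := by
    rw [gaussianReal_apply _ one_ne_zero]
    calc ∫⁻ y in Set.Ioc x (x + ε), gaussianPDF 0 1 y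
        ≤ ∫⁻ _ in Set.Ioc x (x + ε), 1 := lintegral_mono fun y => by
          rw [gaussianPDF, ← ENNReal.ofReal_one]
          refine ENNReal.ofReal_le_ofReal ?_
          rw [gaussianPDFReal]
          refine mul_le_one₀ (inv_le_one_of_one_le₀ ?_) (Real.exp_nonneg _) ?_
          · rw [Real.one_le_sqrt]
            norm_num
            linarith [Real.pi_gt_three]
          · rw [Real.exp_le_one_iff]
            rw [neg_div]
            have : 0 ≤ (y - 0) ^ 2 / (2 * ((1 : ℝ≥0) : ℝ)) := by positivity
            linarith
      _ = ENNReal.ofReal ε := by simp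
  have h3 : (gaussianReal 0 1).real (Set.Ioc x (x + ε)) ≤ ε :=
    ENNReal.toReal_le_of_le_ofReal hε h2
  rw [h1]
  exact (measureReal_union_le _ _).trans (by linarith)

lemma gaussianReal_real_Iic_mul {σ : ℝ} (hσ : 0 < σ) (x : ℝ) :
    (gaussianReal 0 (σ ^ 2).toNNReal).real (Set.Iic (σ * x)) =
      (gaussianReal 0 1).real (Set.Iic x) := by
  have h : gaussianReal 0 (σ ^ 2).toNNReal = (gaussianReal 0 1).map (σ * ·) := by
    rw [gaussianReal_map_const_mul]
    congr
    · simp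
    · ext; simp [sq_nonneg]
  rw [h, map_measureReal_apply (by fun_prop) measurableSet_Iic]
  congr 1
  ext y
  simp [mul_le_mul_iff_right₀ hσ]

/-- A smooth step at `x` of width `a` separates the distribution functions at `x` and `x + a`. -/
lemma real_Iic_le_integral_step {Ω : Type*} [MeasurableSpace Ω] {P : Measure Ω}
    [IsProbabilityMeasure P] {W : Ω → ℝ} (hW : Measurable W) {φ : ℝ → ℝ} (hc : Continuous φ)
    (h0 : ∀ x, 0 ≤ φ x) (h1 : ∀ x, φ x ≤ 1) (hneg : ∀ x ≤ 0, φ x = 1)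
    (hpos : ∀ x, 1 ≤ x → φ x = 0) (x : ℝ) {a : ℝ} (ha : 0 < a) :
    P.real {ω | W ω ≤ x} ≤ ∫ ω, φ ((W ω - x) / a) ∂P ∧
      ∫ ω, φ ((W ω - x) / a) ∂P ≤ P.real {ω | W ω ≤ x + a} := by
  have hm (z : ℝ) : MeasurableSet {ω | W ω ≤ z} := measurableSet_le hW measurable_const
  have hi : Integrable (fun ω => φ ((W ω - x) / a)) P :=
    Integrable.of_bound (hc.measurable.comp ((hW.sub_const x).div_const a)).aestronglyMeasurable 1
      (ae_of_all _ fun ω => by rw [Real.norm_eq_abs, abs_of_nonneg (h0 _)]; exact h1 _)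
  have hind (z : ℝ) : Integrable ({ω | W ω ≤ z}.indicator (1 : Ω → ℝ)) P :=
    (integrable_const 1).indicator (hm z)
  constructor
  · rw [← integral_indicator_one (hm x)]
    refine integral_mono (hind x) hi fun ω => ?_
    by_cases h : W ω ≤ x
    · have : φ ((W ω - x) / a) = 1 := hneg _ (div_nonpos_of_nonpos_of_nonneg (by linarith) ha.le)
      simp [Set.indicator, h, this]
    · simp [Set.indicator, h, h0]
  · rw [← integral_indicator_one (hm (x + a))]
    refine integral_mono hi (hind (x + a)) fun ω => ?_
    by_cases h : W ω ≤ x + a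
    · simp [Set.indicator, h, h1]
    · have : φ ((W ω - x) / a) = 0 := hpos _ (by rw [le_div_iff₀ ha]; linarith)
      simp [Set.indicator, h, this]

/-- Berry-Esseen type bound, at the smoothing scale `ε`. -/
lemma exists_kolmogorovDist_le : ∃ K : ℝ, 0 < K ∧
    ∀ {Ω : Type} [MeasurableSpace Ω] {P : Measure Ω} [IsProbabilityMeasure P] {f : ℕ → Ω → ℝ}
      {n L : ℕ} {η : ℝ}, IsWeaklyDependent P f n L η → 0 < n → 1 ≤ L → n * η ≤ 1 →
      ∀ {σ ε : ℝ}, 0 < σ → ∫ ω, partialSum f n ω ^ 2 ∂P = σ ^ 2 → 1 ≤ ε * σ → ε * σ ≤ n →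
      kolmogorovDist P (fun ω => partialSum f n ω / σ) (gaussianReal 0 1) (fun y => y) ≤
        ε + K * (n * (L : ℝ) ^ 4 / (ε * σ) ^ 3) := by
  obtain ⟨φ, φ₁, φ₂, c, hc, hφ, h0, h1, hneg, hpos⟩ := exists_step_isTestFunction
  have hH := one_le_heatConst
  -- `88 = 42 + 2 + 4 + 40` collects the coefficients in `abs_integral_sub_heat_le`.
  refine ⟨88 * heatConst * c, by positivity, ?_⟩
  intro Ω _ P _ f n L η hf hn hL hη σ ε hσ hvar ha han
  have hL1 : (1 : ℝ) ≤ L := by exact_mod_cast hL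
  have hn1 : (1 : ℝ) ≤ n := by exact_mod_cast hn
  have hη0 := hf.eta_nonneg hn
  set a := ε * σ with hadef
  have ha0 : 0 < a := by linarith
  have hε : 0 < ε := pos_of_mul_pos_left ha0 hσ.le
  set E := 88 * heatConst * c * (n * (L : ℝ) ^ 4 / a ^ 3) with hE
  have hS := hf.boundedMeasurable_partialSum n
  have key (x : ℝ) : |∫ ω, φ ((partialSum f n ω - x) / a) ∂P -
      ∫ y, φ ((y - x) / a) ∂gaussianReal 0 (σ ^ 2).toNNReal| ≤ E := by
    have e1 := hf.abs_integral_sub_heat_le hn hL hη (hφ.comp_sub_div x ha)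
    rw [hvar] at e1
    simp only [heat, zero_add] at e1
    refine e1.trans ?_
    -- The width is at most `n`, which lets the second order errors be absorbed into the third order
    -- one.
    have p1 : c / a ^ 2 ≤ n * (L : ℝ) ^ 4 * c / a ^ 3 := by
      rw [div_le_div_iff₀ (by positivity) (by positivity)]
      have : 1 ≤ (L : ℝ) ^ 4 := one_le_pow₀ hL1
      have q1 : a ≤ n * (L : ℝ) ^ 4 := by nlinarith
      have q2 := mul_le_mul_of_nonneg_right q1 (show 0 ≤ c * a ^ 2 by positivity)
      nlinarith
    have p1' : (L : ℝ) ^ 2 * (c / a ^ 2) ≤ n * (L : ℝ) ^ 4 * c / a ^ 3 := by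
      rw [← mul_div_assoc, div_le_div_iff₀ (by positivity) (by positivity)]
      have : (L : ℝ) ^ 2 ≤ (L : ℝ) ^ 4 := pow_le_pow_right₀ hL1 (by norm_num)
      have q1 : a * (L : ℝ) ^ 2 ≤ n * (L : ℝ) ^ 4 :=
        mul_le_mul han this (by positivity) (by positivity)
      have q2 := mul_le_mul_of_nonneg_right q1 (show 0 ≤ c * a ^ 2 by positivity)
      nlinarith
    have p2 : n * (2 * (c / a ^ 2) * η) ≤ 2 * (n * (L : ℝ) ^ 4 * c / a ^ 3) := by
      have : n * (2 * (c / a ^ 2) * η) = 2 * (c / a ^ 2) * (n * η) := by ring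
      rw [this]
      have h2 : 0 ≤ 2 * (c / a ^ 2) := by positivity
      nlinarith
    have p3 : n * (L : ℝ) ^ 2 * (c / a ^ 3) ≤ n * (L : ℝ) ^ 4 * c / a ^ 3 := by
      rw [mul_div_assoc]
      have : (L : ℝ) ^ 2 ≤ (L : ℝ) ^ 4 := pow_le_pow_right₀ hL1 (by norm_num)
      exact mul_le_mul_of_nonneg_right (mul_le_mul_of_nonneg_left this (by positivity))
        (by positivity)
    have p4 : (L : ℝ) ^ 4 * (c / a ^ 3) ≤ n * (L : ℝ) ^ 4 * c / a ^ 3 := by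
      rw [mul_div_assoc, mul_assoc]
      exact le_mul_of_one_le_left (by positivity) hn1
    set Q := n * (L : ℝ) ^ 4 * c / a ^ 3 with hQ
    have hQ0 : 0 ≤ Q := by positivity
    have hEQ : E = 88 * heatConst * Q := by rw [hE, hQ]; ring
    have r1 := mul_le_mul_of_nonneg_left p3 (show 0 ≤ 42 * heatConst by positivity)
    have r2 := mul_le_mul_of_nonneg_left p4 (show 0 ≤ 40 * heatConst by positivity)
    have r3 : Q ≤ heatConst * Q := le_mul_of_one_le_left hQ0 hH
    rw [hEQ]
    nlinarith
  refine ciSup_le fun x => ?_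
  have hset (z : ℝ) : {ω | partialSum f n ω / σ ≤ z} = {ω | partialSum f n ω ≤ σ * z} := by
    ext ω
    simp [div_le_iff₀' hσ]
  have hG (z : ℝ) : (gaussianReal 0 (σ ^ 2).toNNReal).real {y | y ≤ σ * z} =
      (gaussianReal 0 1).real {y | y ≤ z} := gaussianReal_real_Iic_mul hσ z
  -- The step at `σ * x` bounds the distribution function of the sum from above, the step at `σ * x
  -- - a` from below. In units of `σ` the width `a` is `ε`, which the Gaussian side pays for.
  have s1 := real_Iic_le_integral_step (P := P) hS.measurable hφ.continuous₀ h0 h1 hneg hpos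
    (σ * x) ha0
  have s2 := real_Iic_le_integral_step (P := P) hS.measurable hφ.continuous₀ h0 h1 hneg hpos
    (σ * x - a) ha0
  have t1 := real_Iic_le_integral_step (P := gaussianReal 0 (σ ^ 2).toNNReal) measurable_id
    hφ.continuous₀ h0 h1 hneg hpos (σ * x) ha0
  have t2 := real_Iic_le_integral_step (P := gaussianReal 0 (σ ^ 2).toNNReal) measurable_id
    hφ.continuous₀ h0 h1 hneg hpos (σ * x - a) ha0
  simp only [id_eq] at t1 t2
  have u1 : σ * x + a = σ * (x + ε) := by rw [hadef]; ring
  have u2 : σ * x - a = σ * (x - ε) := by rw [hadef]; ring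
  rw [u1, hG, hG] at t1
  rw [sub_add_cancel] at s2 t2
  have k1 := key (σ * x)
  have k2 := key (σ * x - a)
  rw [u2] at t2 s2 k2
  rw [hG, hG] at t2
  have g1 := gaussianReal_Iic_add_le x hε.le
  have g2 := gaussianReal_Iic_add_le (x - ε) hε.le
  rw [sub_add_cancel] at g2
  simp only [Set.Iic] at g1 g2
  rw [hset]
  rw [abs_le] at k1 k2 ⊢
  constructor <;> linarith [s1.1, s2.2, t1.2, t2.1]

/-! ### Functions of bounded variation on the circle -/

lemma eVariationOn_add_le (f g : ℝ → ℝ) (s : Set ℝ) :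
    eVariationOn (fun x => f x + g x) s ≤ eVariationOn f s + eVariationOn g s := by
  refine iSup_le fun p => ?_
  refine (Finset.sum_le_sum fun i _ => edist_add_add_le _ _ _ _).trans ?_
  rw [Finset.sum_add_distrib]
  exact add_le_add (eVariationOn.sum_le p.2.2.1 p.2.2.2) (eVariationOn.sum_le p.2.2.1 p.2.2.2)

lemma eVariationOn_sum_le {ι : Type*} (f : ι → ℝ → ℝ) (t : Finset ι) (s : Set ℝ) :
    eVariationOn (fun x => ∑ i ∈ t, f i x) s ≤ ∑ i ∈ t, eVariationOn (f i) s := by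
  classical
  induction t using Finset.induction_on with
  | empty =>
    simp only [Finset.sum_empty]
    exact (eVariationOn.constant_on (Set.subsingleton_singleton.anti
      (Set.image_subset_iff.2 fun x _ => Set.mem_singleton (0 : ℝ)))).le
  | insert a t ha ih =>
    simp only [Finset.sum_insert ha]
    exact (eVariationOn_add_le _ _ _).trans (add_le_add le_rfl ih)

instance : IsProbabilityMeasure circleMeasure := ⟨by simp [circleMeasure]⟩

/-- Measurability comes from writing `f` as a difference of monotone functions, boundedness from
comparison with the value at `0`. -/
lemma BoundedVariationOn.memLp_top_circleMeasure {f : ℝ → ℝ}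
    (hf : BoundedVariationOn f (Set.Ico 0 1)) : MemLp f ⊤ circleMeasure := by
  obtain ⟨p, q, hp, hq, rfl⟩ := hf.locallyBoundedVariationOn.exists_monotoneOn_sub_monotoneOn
  have hm : AEMeasurable (p - q) circleMeasure :=
    (aemeasurable_restrict_of_monotoneOn measurableSet_Ico hp).sub
      (aemeasurable_restrict_of_monotoneOn measurableSet_Ico hq)
  refine memLp_top_of_bound hm.aestronglyMeasurable
    (|(p - q) 0| + (eVariationOn (p - q) (Set.Ico 0 1)).toReal) ?_
  refine (ae_restrict_iff' measurableSet_Ico).2 (ae_of_all _ fun x hx => ?_)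
  have := hf.dist_le hx (show (0 : ℝ) ∈ Set.Ico 0 1 by simp)
  rw [Real.dist_eq] at this
  rw [Real.norm_eq_abs]
  calc |(p - q) x| = |(p - q) 0 + ((p - q) x - (p - q) 0)| := by congr 1; ring
    _ ≤ _ := (abs_add_le _ _).trans (by gcongr)

/-- Centering a Lipschitz function of a sum of functions of bounded variation. -/
lemma isCenteredBV_comp_sum {f : ℕ → ℝ → ℝ} {t : Finset ℕ}
    (hf : ∀ i ∈ t, BoundedVariationOn (f i) (Set.Ico 0 1)) {g : ℝ → ℝ} {M : ℝ≥0}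
    (hg : LipschitzWith M g) :
    IsCenteredBV (fun x => g (∑ i ∈ t, f i x) - ∫ y, g (∑ i ∈ t, f i y) ∂circleMeasure) ∧
      circleVariation
        (fun x => g (∑ i ∈ t, f i x) - ∫ y, g (∑ i ∈ t, f i y) ∂circleMeasure) ≤
      M * ∑ i ∈ t, circleVariation (f i) := by
  have hsum := eVariationOn_sum_le f t (Set.Ico 0 1)
  have hfin : ∑ i ∈ t, eVariationOn (f i) (Set.Ico 0 1) ≠ ⊤ :=
    ENNReal.sum_ne_top.2 fun i hi => hf i hi
  set c := ∫ y, g (∑ i ∈ t, f i y) ∂circleMeasure with hc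
  have hgc : LipschitzWith M fun y => g y - c := LipschitzWith.of_dist_le_mul fun x y => by
    simpa using hg.dist_le_mul x y
  have hcomp := hgc.lipschitzOnWith.comp_eVariationOn_le (s := Set.Ico (0 : ℝ) 1)
    (g := fun x => ∑ i ∈ t, f i x) (Set.mapsTo_univ _ _)
  have hle : eVariationOn (fun x => g (∑ i ∈ t, f i x) - c) (Set.Ico 0 1) ≤
      M * ∑ i ∈ t, eVariationOn (f i) (Set.Ico 0 1) :=
    hcomp.trans (mul_le_mul_right hsum _)
  have htop : (M : ENNReal) * ∑ i ∈ t, eVariationOn (f i) (Set.Ico 0 1) ≠ ⊤ :=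
    ENNReal.mul_ne_top ENNReal.coe_ne_top hfin
  refine ⟨⟨ne_top_of_le_ne_top htop hle, ?_⟩, ?_⟩
  · have hbv : BoundedVariationOn (fun x => g (∑ i ∈ t, f i x)) (Set.Ico 0 1) :=
      hg.comp_boundedVariationOn (f := g) (g := fun x => ∑ i ∈ t, f i x)
        (ne_top_of_le_ne_top hfin hsum)
    rw [integral_sub (hbv.memLp_top_circleMeasure.integrable le_top) (integrable_const _)]
    simp [hc]
  · refine (ENNReal.toReal_mono htop hle).trans_eq ?_
    rw [ENNReal.toReal_mul, ENNReal.toReal_sum fun i hi => hf i hi]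
    rfl

/-- Truncating a measurable version turns an almost everywhere bound into the everywhere bound that
`IsWeaklyDependent` demands. -/
lemma exists_bounded_measurable_ae_eq {α : Type*} [MeasurableSpace α] {μ : Measure α} {f : α → ℝ}
    (hf : AEMeasurable f μ) (hb : ∀ᵐ x ∂μ, |f x| ≤ 1) :
    ∃ F : α → ℝ, Measurable F ∧ (∀ x, |F x| ≤ 1) ∧ F =ᵐ[μ] f := by
  refine ⟨fun x => max (-1) (min 1 (hf.mk f x)),
    measurable_const.max (measurable_const.min hf.measurable_mk), fun x => ?_, ?_⟩
  · exact abs_le.2 ⟨le_max_left _ _, max_le (by norm_num) (min_le_left _ _)⟩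
  · filter_upwards [hb, hf.ae_eq_mk] with x h1 h2
    rw [abs_le] at h1
    rw [← h2, min_eq_right h1.2, max_eq_right h1.1]

lemma kolmogorovDist_congr_ae {Ω Ω' : Type*} [MeasurableSpace Ω] [MeasurableSpace Ω']
    {P : Measure Ω} {X X' : Ω → ℝ} (h : X =ᵐ[P] X') (Q : Measure Ω') (Y : Ω' → ℝ) :
    kolmogorovDist P X Q Y = kolmogorovDist P X' Q Y := by
  unfold kolmogorovDist
  congr with x
  congr 2
  refine measureReal_congr ?_
  filter_upwards [h] with ω hω
  exact propext (by change X ω ≤ x ↔ X' ω ≤ x; rw [hω])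

lemma kolmogorovDist_le_one {Ω Ω' : Type*} [MeasurableSpace Ω] [MeasurableSpace Ω']
    (P : Measure Ω) [IsProbabilityMeasure P] (X : Ω → ℝ) (Q : Measure Ω') [IsProbabilityMeasure Q]
    (Y : Ω' → ℝ) : kolmogorovDist P X Q Y ≤ 1 := by
  refine ciSup_le fun x => ?_
  have h1 : P.real {ω | X ω ≤ x} ≤ 1 := measureReal_le_one
  have h2 : Q.real {ω | Y ω ≤ x} ≤ 1 := measureReal_le_one
  have h3 : 0 ≤ P.real {ω | X ω ≤ x} := measureReal_nonneg
  have h4 : 0 ≤ Q.real {ω | Y ω ≤ x} := measureReal_nonneg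
  rw [abs_le]
  constructor <;> linarith

/-! ### Choice of the gap and of the smoothing scale -/

/-- A logarithmic gap compensates a polynomial factor. -/
lemma exists_gap {D p ρ δ : ℝ} (hD : 0 < D) (hp : 0 ≤ p) (hρ : 0 < ρ) (hρ1 : ρ < 1) (hδ : 0 < δ) :
    ∃ K : ℝ, 0 < K ∧ ∀ n : ℕ, 1 ≤ n → ∃ L : ℕ, 1 ≤ L ∧ D * (n : ℝ) ^ p * ρ ^ L ≤ 1 ∧
      (L : ℝ) ≤ K * (n : ℝ) ^ δ := by
  have hl : 0 < -Real.log ρ := neg_pos.2 (Real.log_neg hρ hρ1)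
  refine ⟨(|Real.log D| + p / δ) / (-Real.log ρ) + 2, by positivity, fun n hn => ?_⟩
  have hn1 : (1 : ℝ) ≤ n := by exact_mod_cast hn
  have hn0 : (0 : ℝ) < n := by linarith
  have hpos : 0 < D * (n : ℝ) ^ p := by positivity
  have hlog : Real.log (D * (n : ℝ) ^ p) = Real.log D + p * Real.log n := by
    rw [Real.log_mul hD.ne' (by positivity), Real.log_rpow hn0]
  have hnδ : 1 ≤ (n : ℝ) ^ δ := Real.one_le_rpow hn1 hδ.le
  -- The real solution of `D * n ^ p * ρ ^ y = 1`; the gap is its ceiling plus one, so that it is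
  -- positive, and `log n ≤ n ^ δ / δ` bounds its size.
  set y := Real.log (D * (n : ℝ) ^ p) / (-Real.log ρ) with hy
  refine ⟨⌈y⌉₊ + 1, by omega, ?_, ?_⟩
  · have h1 : y ≤ (⌈y⌉₊ + 1 : ℕ) := by
      push_cast
      linarith [Nat.le_ceil y]
    have h2 : Real.log (D * (n : ℝ) ^ p) = y * -Real.log ρ := by rw [hy, div_mul_cancel₀ _ hl.ne']
    have h3 := mul_le_mul_of_nonneg_right h1 hl.le
    rw [← Real.log_nonpos_iff (by positivity), Real.log_mul hpos.ne' (by positivity), Real.log_pow]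
    linarith
  · have h2 : y ≤ (|Real.log D| + p / δ) / (-Real.log ρ) * (n : ℝ) ^ δ := by
      rw [hy, div_mul_eq_mul_div, hlog]
      refine div_le_div_of_nonneg_right ?_ hl.le
      have h3 := Real.log_le_rpow_div hn0.le hδ
      have h4 : p * Real.log n ≤ p / δ * (n : ℝ) ^ δ :=
        (mul_le_mul_of_nonneg_left h3 hp).trans_eq (by ring)
      have h5 := le_abs_self (Real.log D)
      have h6 : |Real.log D| ≤ |Real.log D| * (n : ℝ) ^ δ :=
        le_mul_of_one_le_right (abs_nonneg _) hnδ
      linarith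
    have h3 : (⌈y⌉₊ : ℝ) ≤ (|Real.log D| + p / δ) / (-Real.log ρ) * (n : ℝ) ^ δ + 1 := by
      rcases le_total y 0 with h | h
      · rw [Nat.ceil_eq_zero.2 h, Nat.cast_zero]
        positivity
      · linarith [Nat.ceil_lt_add_one h]
    push_cast
    linarith

/-- Write the rate as `s * A` with `s = σ ^ (-2/3)` and `A = n ^ (1/4 + δ)`. Then `(s * A * σ) ^ 3 =
A ^ 3 * σ` and `n * l ^ 4 ≤ K ^ 4 * A ^ 4`, so the error is at most `K ^ 4 * A / σ`. As `A ≥ 1`, a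
rate below one forces `σ > 1`, whence `s * σ ≥ 1` and `1 / σ ≤ s`. -/
lemma smoothing_error_le_of_rate_lt_one {n l σ δ K : ℝ} (hn : 1 ≤ n) (hσ : 0 < σ) (hδ : 0 < δ)
    (hl : 0 ≤ l) (hlK : l ≤ K * n ^ δ) (hR : (1 / σ) ^ (2 / 3 : ℝ) * n ^ (1 / 4 + δ) < 1) :
    1 ≤ (1 / σ) ^ (2 / 3 : ℝ) * n ^ (1 / 4 + δ) * σ ∧
      n * l ^ 4 / ((1 / σ) ^ (2 / 3 : ℝ) * n ^ (1 / 4 + δ) * σ) ^ 3 ≤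
        K ^ 4 * ((1 / σ) ^ (2 / 3 : ℝ) * n ^ (1 / 4 + δ)) := by
  have hn0 : 0 < n := by linarith
  have hA : 1 ≤ n ^ (1 / 4 + δ) := Real.one_le_rpow hn (by positivity)
  have hA4 : (n ^ (1 / 4 + δ)) ^ 4 = n * (n ^ δ) ^ 4 := by
    rw [← Real.rpow_mul_natCast hn0.le, ← Real.rpow_mul_natCast hn0.le]
    nth_rewrite 2 [← Real.rpow_one n]
    rw [← Real.rpow_add hn0]
    congr 1
    push_cast
    ring
  have hs0 : 0 < (1 / σ) ^ (2 / 3 : ℝ) := by positivity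
  have hs3 : ((1 / σ) ^ (2 / 3 : ℝ)) ^ 3 * σ ^ 2 = 1 := by
    rw [← Real.rpow_mul_natCast (by positivity)]
    norm_num
    field_simp
  have hσ1 : 1 < σ := by
    by_contra h
    have h1 : 1 ≤ (1 / σ) ^ (2 / 3 : ℝ) :=
      Real.one_le_rpow (by rw [le_div_iff₀ hσ]; linarith) (by norm_num)
    nlinarith
  set s := (1 / σ) ^ (2 / 3 : ℝ) with hs
  set A := n ^ (1 / 4 + δ) with hAdef
  have hA0 : 0 < A := by linarith
  have hcube : (s * A * σ) ^ 3 = A ^ 3 * σ := by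
    calc (s * A * σ) ^ 3 = (s ^ 3 * σ ^ 2) * (A ^ 3 * σ) := by ring
      _ = _ := by rw [hs3, one_mul]
  have hsσ : 1 ≤ s * σ := by
    refine (one_le_pow_iff_of_nonneg (by positivity) (show (3 : ℕ) ≠ 0 by norm_num)).1 ?_
    calc (1 : ℝ) ≤ σ := hσ1.le
      _ = (s ^ 3 * σ ^ 2) * σ := by rw [hs3, one_mul]
      _ = (s * σ) ^ 3 := by ring
  refine ⟨?_, ?_⟩
  · calc (1 : ℝ) ≤ (s * σ) * A := one_le_mul_of_one_le_of_one_le hsσ hA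
      _ = s * A * σ := by ring
  · rw [hcube, div_le_iff₀ (by positivity)]
    have h1 : l ^ 4 ≤ K ^ 4 * (n ^ δ) ^ 4 := by
      rw [← mul_pow]
      exact pow_le_pow_left₀ hl hlK 4
    calc n * l ^ 4 ≤ n * (K ^ 4 * (n ^ δ) ^ 4) := mul_le_mul_of_nonneg_left h1 hn0.le
      _ = K ^ 4 * A ^ 4 * 1 := by rw [hA4]; ring
      _ ≤ K ^ 4 * A ^ 4 * (s * σ) := mul_le_mul_of_nonneg_left hsσ (by positivity)
      _ = _ := by ring

/-! ### From lacunarity to weak dependence -/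

/-- The centered function `g (partialSum F j)` agrees almost everywhere with a centered BV function
of variation at most `M * C` times the sum of the first `j` frequencies. Divided by a frequency at
least `L` indices later, each of these is at most `C * ρ ^ L`. The indices of `F` start at `0`,
those of `f` at `1`. -/
lemma isWeaklyDependent_of_lacunary {C θ ρ : ℝ} (hC : 0 < C) (hρ0 : 0 < ρ) (hρ : ρ < 1) {n : ℕ}
    {q : ℕ → ℕ} {f : ℕ → ℝ → ℝ} {u : ℕ → ℝ}
    (hlac : ∀ k m, 1 ≤ k → k < m → m ≤ n → (q k : ℝ) / q m ≤ C * ρ ^ (m - k))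
    (hbv : ∀ k, 1 ≤ k → k ≤ n → IsCenteredBV (f k))
    (hvar : ∀ k, 1 ≤ k → k ≤ n → circleVariation (f k) ≤ C * u k * q k)
    (h1 : ∀ ψ : ℝ → ℝ, IsCenteredBV ψ → ∀ k, 1 ≤ k → k ≤ n →
      |∫ x, ψ x * f k x ∂circleMeasure| ≤ C * circleVariation ψ * u k * ((k : ℝ) ^ θ / q k))
    (h2 : ∀ ψ : ℝ → ℝ, IsCenteredBV ψ → ∀ k m, 1 ≤ k → k ≤ m → m ≤ n →
      |∫ x, ψ x * f k x * f m x ∂circleMeasure| ≤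
        C * circleVariation ψ * u k * u m * ((m : ℝ) ^ θ / q k))
    {U : ℝ} (hU : 0 < U) (hu0 : ∀ k, 1 ≤ k → k ≤ n → 0 ≤ u k)
    (huU : ∀ k, 1 ≤ k → k ≤ n → u k ≤ U) {L : ℕ} (hL : 1 ≤ L) {F : ℕ → ℝ → ℝ}
    (hFm : ∀ k, Measurable (F k)) (hF1 : ∀ k x, |F k x| ≤ 1)
    (hFf : ∀ k < n, F k =ᵐ[circleMeasure] fun x => f (k + 1) x / U) :
    IsWeaklyDependent circleMeasure F n L (C ^ 3 * (n : ℝ) ^ (1 + |θ|) * ρ ^ L) := by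
  have hb (k : ℕ) : IsBoundedMeasurable (F k) := ⟨hFm k, 1, hF1 k⟩
  have hS (j : ℕ) : IsBoundedMeasurable (partialSum F j) := .sum hb
  have hSf (j : ℕ) (hj : j ≤ n) : ∀ᵐ x ∂circleMeasure,
      partialSum F j x = (∑ i ∈ Finset.range j, f (i + 1) x) / U := by
    have : ∀ᵐ x ∂circleMeasure, ∀ k, k < n → F k x = f (k + 1) x / U :=
      ae_all_iff.2 fun k => by
        by_cases hk : k < n
        · filter_upwards [hFf k hk] with x hx _ using hx
        · exact ae_of_all _ fun x h => absurd h hk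
    filter_upwards [this] with x hx
    rw [partialSum, Finset.sum_div]
    exact Finset.sum_congr rfl fun i hi => hx i (by have := Finset.mem_range.1 hi; omega)
  have hlip (g : ℝ → ℝ) (M : ℝ≥0) (hg : LipschitzWith M g) :
      LipschitzWith (M * U⁻¹.toNNReal) fun y => g (y / U) :=
    hg.comp (LipschitzWith.of_dist_le_mul fun x y => by
      rw [Real.coe_toNNReal _ (by positivity), Real.dist_eq, Real.dist_eq, ← sub_div, abs_div,
        abs_of_pos hU, div_eq_inv_mul])
  have hcentered (g : ℝ → ℝ) (M : ℝ≥0) (hg : LipschitzWith M g) (j : ℕ) (hj : j ≤ n) :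
      ∃ ψ : ℝ → ℝ, IsCenteredBV ψ ∧
        circleVariation ψ ≤ M * C * ∑ i ∈ Finset.range j, (q (i + 1) : ℝ) ∧
        ∀ᵐ x ∂circleMeasure, g (partialSum F j x) -
          ∫ y, g (partialSum F j y) ∂circleMeasure = ψ x := by
    have hbvj : ∀ i ∈ Finset.range j, BoundedVariationOn (f (i + 1)) (Set.Ico 0 1) := fun i hi =>
      (hbv (i + 1) (by omega) (by have := Finset.mem_range.1 hi; omega)).boundedVariation
    obtain ⟨hψ, hV⟩ := isCenteredBV_comp_sum (f := fun i => f (i + 1)) hbvj (hlip g M hg)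
    refine ⟨_, hψ, hV.trans ?_, ?_⟩
    · have : ∑ i ∈ Finset.range j, circleVariation (f (i + 1)) ≤
          ∑ i ∈ Finset.range j, C * U * q (i + 1) := Finset.sum_le_sum fun i hi => by
        have hi := Finset.mem_range.1 hi
        refine (hvar (i + 1) (by omega) (by omega)).trans ?_
        exact mul_le_mul_of_nonneg_right (mul_le_mul_of_nonneg_left
          (huU (i + 1) (by omega) (by omega)) hC.le) (Nat.cast_nonneg _)
      refine (mul_le_mul_of_nonneg_left this (NNReal.coe_nonneg _)).trans_eq ?_
      rw [← Finset.mul_sum, NNReal.coe_mul, Real.coe_toNNReal _ (by positivity)]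
      field_simp
    · have hc : ∫ y, g (partialSum F j y) ∂circleMeasure =
          ∫ y, g ((∑ i ∈ Finset.range j, f (i + 1) y) / U) ∂circleMeasure :=
        integral_congr_ae (by filter_upwards [hSf j hj] with x hx; rw [hx])
      filter_upwards [hSf j hj] with x hx
      rw [hx, hc]
  -- The three factors `C` come from the correlation hypothesis, the variation bound and lacunarity;
  -- `n` counts the frequencies and `n ^ |θ|` dominates `(k + 1) ^ θ` for either sign of `θ`.
  have hrate (M : ℝ≥0) (k m j : ℕ) (hk : k < n) (hm : m ≤ k) (hj : j ≤ m - L) {V : ℝ}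
      (hV : V ≤ M * C * ∑ i ∈ Finset.range j, (q (i + 1) : ℝ)) :
      C * V * (((k + 1 : ℕ) : ℝ) ^ θ / q (m + 1)) ≤
        M * (C ^ 3 * (n : ℝ) ^ (1 + |θ|) * ρ ^ L) := by
    have hn1 : (1 : ℝ) ≤ n := by exact_mod_cast (by omega : 1 ≤ n)
    have hk1 : (1 : ℝ) ≤ (k + 1 : ℕ) := by exact_mod_cast (by omega : 1 ≤ k + 1)
    have e1 : (∑ i ∈ Finset.range j, (q (i + 1) : ℝ)) / q (m + 1) ≤ n * (C * ρ ^ L) := by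
      rw [Finset.sum_div]
      refine (Finset.sum_le_card_nsmul _ _ (C * ρ ^ L) fun i hi => ?_).trans ?_
      · have hi := Finset.mem_range.1 hi
        refine (hlac (i + 1) (m + 1) (by omega) (by omega) (by omega)).trans ?_
        exact mul_le_mul_of_nonneg_left
          (pow_le_pow_of_le_one hρ0.le hρ.le (by omega)) hC.le
      · rw [nsmul_eq_mul, Finset.card_range]
        exact mul_le_mul_of_nonneg_right (by exact_mod_cast (by omega : j ≤ n)) (by positivity)
    have e2 : ((k + 1 : ℕ) : ℝ) ^ θ ≤ (n : ℝ) ^ |θ| :=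
      (Real.rpow_le_rpow_of_exponent_le hk1 (le_abs_self θ)).trans
        (Real.rpow_le_rpow (by positivity) (by exact_mod_cast hk) (abs_nonneg _))
    have e3 : (n : ℝ) ^ (1 + |θ|) = n * (n : ℝ) ^ |θ| := by
      rw [Real.rpow_add (by positivity), Real.rpow_one]
    calc C * V * (((k + 1 : ℕ) : ℝ) ^ θ / q (m + 1))
        ≤ C * (M * C * ∑ i ∈ Finset.range j, (q (i + 1) : ℝ)) *
          (((k + 1 : ℕ) : ℝ) ^ θ / q (m + 1)) := by gcongr
      _ = M * C ^ 2 * ((∑ i ∈ Finset.range j, (q (i + 1) : ℝ)) / q (m + 1)) *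
          ((k + 1 : ℕ) : ℝ) ^ θ := by ring
      _ ≤ M * C ^ 2 * (n * (C * ρ ^ L)) * (n : ℝ) ^ |θ| := by gcongr
      _ = _ := by rw [e3]; ring
  have hV0 (ψ : ℝ → ℝ) : 0 ≤ circleVariation ψ := ENNReal.toReal_nonneg
  refine ⟨hFm, hF1, fun g M hg k hk j hj => ?_, fun g M hg k hk m hm j hj => ?_⟩
  · obtain ⟨ψ, hψ, hV, hae⟩ := hcentered g M hg j (by omega)
    have hF0 : ∫ x, F k x ∂circleMeasure = 0 := by
      rw [integral_congr_ae (hFf k hk), integral_div,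
        (hbv (k + 1) (by omega) (by omega)).integral_eq_zero, zero_div]
    have e1 : ∫ x, g (partialSum F j x) * F k x ∂circleMeasure =
        (∫ x, ψ x * f (k + 1) x ∂circleMeasure) / U := by
      have hgS := (hS j).comp hg.continuous
      calc _ = ∫ x, (g (partialSum F j x) - ∫ y, g (partialSum F j y) ∂circleMeasure) * F k x
            ∂circleMeasure := by
            simp only [sub_mul]
            rw [integral_sub (hgS.mul (hb k)).integrable
              ((IsBoundedMeasurable.const _).mul (hb k)).integrable, integral_const_mul, hF0,
              mul_zero, sub_zero]
        _ = ∫ x, ψ x * f (k + 1) x / U ∂circleMeasure := by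
            refine integral_congr_ae ?_
            filter_upwards [hae, hFf k hk] with x hx1 hx2
            rw [hx1, hx2, mul_div_assoc]
        _ = _ := integral_div _ _
    rw [e1, abs_div, abs_of_pos hU, div_le_iff₀ hU]
    refine (h1 ψ hψ (k + 1) (by omega) (by omega)).trans ?_
    have e2 := hrate M k k j hk le_rfl hj hV
    have hx : 0 ≤ C * circleVariation ψ * (((k + 1 : ℕ) : ℝ) ^ θ / q (k + 1)) := by
      have := hV0 ψ
      positivity
    calc _ = C * circleVariation ψ * (((k + 1 : ℕ) : ℝ) ^ θ / q (k + 1)) * u (k + 1) := by ring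
      _ ≤ C * circleVariation ψ * (((k + 1 : ℕ) : ℝ) ^ θ / q (k + 1)) * U :=
          mul_le_mul_of_nonneg_left (huU _ (by omega) (by omega)) hx
      _ ≤ _ := mul_le_mul_of_nonneg_right e2 hU.le
  · obtain ⟨ψ, hψ, hV, hae⟩ := hcentered g M hg j (by omega)
    have e1 : ∫ x, g (partialSum F j x) * (F m x * F k x) ∂circleMeasure -
        (∫ x, g (partialSum F j x) ∂circleMeasure) * ∫ x, F m x * F k x ∂circleMeasure =
        (∫ x, ψ x * f (m + 1) x * f (k + 1) x ∂circleMeasure) / (U * U) := by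
      have hgS := (hS j).comp hg.continuous
      have hmk := (hb m).mul (hb k)
      calc _ = ∫ x, (g (partialSum F j x) - ∫ y, g (partialSum F j y) ∂circleMeasure) *
            (F m x * F k x) ∂circleMeasure := by
            rw [← integral_const_mul, ← integral_sub (hgS.mul hmk).integrable
              ((IsBoundedMeasurable.const _).mul hmk).integrable]
            simp only [sub_mul]
        _ = ∫ x, ψ x * f (m + 1) x * f (k + 1) x / (U * U) ∂circleMeasure := by
            refine integral_congr_ae ?_
            filter_upwards [hae, hFf k hk, hFf m (by omega)] with x hx1 hx2 hx3
            rw [hx1, hx2, hx3]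
            field_simp
        _ = _ := integral_div _ _
    rw [e1, abs_div, abs_of_pos (mul_pos hU hU), div_le_iff₀ (mul_pos hU hU)]
    refine (h2 ψ hψ (m + 1) (k + 1) (by omega) (by omega) (by omega)).trans ?_
    have e2 := hrate M k m j hk hm hj hV
    have hx : 0 ≤ C * circleVariation ψ * (((k + 1 : ℕ) : ℝ) ^ θ / q (m + 1)) := by
      have := hV0 ψ
      positivity
    calc _ = C * circleVariation ψ * (((k + 1 : ℕ) : ℝ) ^ θ / q (m + 1)) *
          (u (m + 1) * u (k + 1)) := by ring
      _ ≤ C * circleVariation ψ * (((k + 1 : ℕ) : ℝ) ^ θ / q (m + 1)) * (U * U) :=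
          mul_le_mul_of_nonneg_left (mul_le_mul (huU _ (by omega) (by omega))
            (huU _ (by omega) (by omega)) (hu0 _ (by omega) (by omega)) hU.le) hx
      _ ≤ _ := mul_le_mul_of_nonneg_right e2 (mul_pos hU hU).le

/-! ### Normalization and conclusion -/

/-- The normalization of a family of functions on the circle by a common bound. -/
lemma exists_normalization {n : ℕ} {f : ℕ → ℝ → ℝ} {u : ℕ → ℝ}
    (hbv : ∀ k, 1 ≤ k → k ≤ n → IsCenteredBV (f k))
    (hnorm : ∀ k, 1 ≤ k → k ≤ n → lpNorm (f k) ⊤ circleMeasure ≤ u k) {U : ℝ} (hU : 0 < U)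
    (huU : ∀ k, 1 ≤ k → k ≤ n → u k ≤ U) :
    ∃ F : ℕ → ℝ → ℝ, (∀ k, Measurable (F k)) ∧ (∀ k x, |F k x| ≤ 1) ∧
      ∀ k < n, F k =ᵐ[circleMeasure] fun x => f (k + 1) x / U := by
  have h (k : ℕ) : ∃ F : ℝ → ℝ, Measurable F ∧ (∀ x, |F x| ≤ 1) ∧
      (k < n → F =ᵐ[circleMeasure] fun x => f (k + 1) x / U) := by
    by_cases hk : k < n
    · have hmem := (hbv (k + 1) (by omega) (by omega)).boundedVariation.memLp_top_circleMeasure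
      have hb : ∀ᵐ x ∂circleMeasure, |f (k + 1) x / U| ≤ 1 := by
        filter_upwards [ae_le_lpNorm_exponent_top hmem] with x hx
        rw [abs_div, abs_of_pos hU, div_le_one hU]
        exact hx.trans ((hnorm _ (by omega) (by omega)).trans (huU _ (by omega) (by omega)))
      obtain ⟨F, h1, h2, h3⟩ := exists_bounded_measurable_ae_eq
        (hmem.aestronglyMeasurable.aemeasurable.div_const U) hb
      exact ⟨F, h1, h2, fun _ => h3⟩
    · exact ⟨fun _ => 0, measurable_const, fun _ => by simp, fun h => absurd h hk⟩
  choose F h1 h2 h3 using h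
  exact ⟨F, h1, h2, h3⟩

lemma sum_Icc_eq_sum_range_succ (a : ℕ → ℝ) (n : ℕ) :
    ∑ k ∈ Finset.Icc 1 n, a k = ∑ k ∈ Finset.range n, a (k + 1) := by
  rw [Finset.range_eq_Ico, Finset.sum_Ico_add' a 0 n 1]
  rfl

lemma lpNorm_two_sq {f : ℝ → ℝ} (hf : AEStronglyMeasurable f circleMeasure) :
    lpNorm f 2 circleMeasure ^ 2 = ∫ x, f x ^ 2 ∂circleMeasure := by
  have h0 : 0 ≤ ∫ x, f x ^ 2 ∂circleMeasure := integral_nonneg fun x => sq_nonneg _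
  rw [lpNorm_eq_integral_norm_rpow_toReal (by norm_num) (by norm_num) hf]
  simp only [ENNReal.toReal_ofNat, Real.rpow_two, Real.norm_eq_abs, sq_abs]
  rw [← Real.rpow_natCast, ← Real.rpow_mul h0]
  norm_num

/-- Normalization of the sum: the ratio of its `L²` norm to the largest bound is at most `n`, and it
may be replaced by a sum of measurable functions bounded by one. -/
lemma normalized_sum {n : ℕ} (hn : 1 ≤ n) {f : ℕ → ℝ → ℝ} {u : ℕ → ℝ}
    (hbv : ∀ k, 1 ≤ k → k ≤ n → IsCenteredBV (f k))
    (hnorm : ∀ k, 1 ≤ k → k ≤ n → lpNorm (f k) ⊤ circleMeasure ≤ u k)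
    (hne : lpNorm (fun x => ∑ k ∈ Finset.Icc 1 n, f k x) 2 circleMeasure ≠ 0) :
    let U := (Finset.Icc 1 n).sup' (Finset.nonempty_Icc.mpr hn) u
    let s := lpNorm (fun x => ∑ k ∈ Finset.Icc 1 n, f k x) 2 circleMeasure
    0 < U ∧ s / U ≤ n ∧ ∃ F : ℕ → ℝ → ℝ, (∀ k, Measurable (F k)) ∧ (∀ k x, |F k x| ≤ 1) ∧
      (∀ k < n, F k =ᵐ[circleMeasure] fun x => f (k + 1) x / U) ∧
      ∫ x, partialSum F n x ^ 2 ∂circleMeasure = (s / U) ^ 2 ∧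
      kolmogorovDist circleMeasure (fun x => (∑ k ∈ Finset.Icc 1 n, f k x) / s)
        (gaussianReal 0 1) (fun y => y) =
      kolmogorovDist circleMeasure (fun x => partialSum F n x / (s / U))
        (gaussianReal 0 1) (fun y => y) := by
  intro U s
  have huU : ∀ k, 1 ≤ k → k ≤ n → u k ≤ U := fun k hk1 hkn =>
    Finset.le_sup' u (Finset.mem_Icc.2 ⟨hk1, hkn⟩)
  have hmem (k : ℕ) (hk1 : 1 ≤ k) (hkn : k ≤ n) :=
    (hbv k hk1 hkn).boundedVariation.memLp_top_circleMeasure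
  have hU0 : 0 ≤ U := lpNorm_nonneg.trans ((hnorm 1 le_rfl hn).trans (huU 1 le_rfl hn))
  have hfU : ∀ᵐ x ∂circleMeasure, ∀ k, 1 ≤ k → k ≤ n → |f k x| ≤ U := by
    refine ae_all_iff.2 fun k => ?_
    by_cases hk : 1 ≤ k ∧ k ≤ n
    · filter_upwards [ae_le_lpNorm_exponent_top (hmem k hk.1 hk.2)] with x hx _ _
      exact hx.trans ((hnorm k hk.1 hk.2).trans (huU k hk.1 hk.2))
    · exact ae_of_all _ fun x h1 h2 => absurd ⟨h1, h2⟩ hk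
  have hm : AEStronglyMeasurable (fun x => ∑ k ∈ Finset.Icc 1 n, f k x) circleMeasure :=
    Finset.aestronglyMeasurable_fun_sum _ fun k hk =>
      (hmem k (Finset.mem_Icc.1 hk).1 (Finset.mem_Icc.1 hk).2).aestronglyMeasurable
  have hs0 : 0 < s := lpNorm_nonneg.lt_of_ne' hne
  have hs2 : s ^ 2 = ∫ x, (∑ k ∈ Finset.Icc 1 n, f k x) ^ 2 ∂circleMeasure := lpNorm_two_sq hm
  have hsU : s ≤ n * U := by
    refine abs_le_of_sq_le_sq' ?_ (by positivity) |>.2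
    rw [hs2]
    have := norm_integral_le_of_norm_le_const (μ := circleMeasure) (C := (n * U) ^ 2)
      (f := fun x => (∑ k ∈ Finset.Icc 1 n, f k x) ^ 2) (by
        filter_upwards [hfU] with x hx
        rw [norm_pow, Real.norm_eq_abs]
        refine pow_le_pow_left₀ (abs_nonneg _) ((Finset.abs_sum_le_sum_abs _ _).trans ?_) 2
        refine (Finset.sum_le_card_nsmul _ _ U fun k hk =>
          hx k (Finset.mem_Icc.1 hk).1 (Finset.mem_Icc.1 hk).2).trans_eq ?_
        rw [nsmul_eq_mul, Nat.card_Icc, Nat.add_sub_cancel])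
    refine (le_abs_self _).trans (this.trans_eq ?_)
    simp
  -- If `U` vanished, `s ≤ n * U` would force the nonzero norm `s` to vanish.
  have hU : 0 < U := by
    refine hU0.lt_of_ne' fun h => ?_
    rw [h, mul_zero] at hsU
    linarith
  obtain ⟨F, hFm, hF1, hFf⟩ := exists_normalization hbv hnorm hU huU
  have hae : ∀ᵐ x ∂circleMeasure, partialSum F n x = (∑ k ∈ Finset.Icc 1 n, f k x) / U := by
    have : ∀ᵐ x ∂circleMeasure, ∀ k, k < n → F k x = f (k + 1) x / U :=
      ae_all_iff.2 fun k => by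
        by_cases hk : k < n
        · filter_upwards [hFf k hk] with x hx _ using hx
        · exact ae_of_all _ fun x h => absurd h hk
    filter_upwards [this] with x hx
    rw [sum_Icc_eq_sum_range_succ, Finset.sum_div]
    exact Finset.sum_congr rfl fun i hi => hx i (Finset.mem_range.1 hi)
  refine ⟨hU, (div_le_iff₀ hU).2 hsU, F, hFm, hF1, hFf, ?_, kolmogorovDist_congr_ae ?_ _ _⟩
  · rw [div_pow, hs2, ← integral_div]
    refine integral_congr_ae ?_
    filter_upwards [hae] with x hx
    rw [hx, div_pow]
  · filter_upwards [hae] with x hx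
    rw [hx]
    field_simp

theorem mainTheorem2 (C θ ρ : ℝ) (hC : 0 < C) (hρ : ρ < 1) (δ : ℝ) (hδ : 0 < δ) :
    ∃ K : ℝ, 0 < K ∧
      ∀ (n : ℕ) (hn : 1 ≤ n) (q : ℕ → ℕ) (f : ℕ → ℝ → ℝ) (u : ℕ → ℝ),
        -- the lacunary sequence `q 1 ≤ … ≤ q n` of positive integers
        MonotoneOn q (Set.Icc 1 n) →
        (∀ k, 1 ≤ k → k ≤ n → 0 < q k) →
        (∀ k m, 1 ≤ k → k < m → m ≤ n → (q k : ℝ) / q m ≤ C * ρ ^ (m - k)) →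
        -- the functions `f 1, …, f n`
        (∀ k, 1 ≤ k → k ≤ n → IsCenteredBV (f k)) →
        (∀ k, 1 ≤ k → k ≤ n → lpNorm (f k) ⊤ circleMeasure ≤ u k) →
        (∀ k, 1 ≤ k → k ≤ n → circleVariation (f k) ≤ C * u k * q k) →
        -- the decorrelation inequalities of order one, two and three
        (∀ ψ : ℝ → ℝ, IsCenteredBV ψ → ∀ k, 1 ≤ k → k ≤ n →
          |∫ x, ψ x * f k x ∂circleMeasure| ≤
            C * circleVariation ψ * u k * ((k : ℝ) ^ θ / q k)) →
        (∀ ψ : ℝ → ℝ, IsCenteredBV ψ → ∀ k m, 1 ≤ k → k ≤ m → m ≤ n →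
          |∫ x, ψ x * f k x * f m x ∂circleMeasure| ≤
            C * circleVariation ψ * u k * u m * ((m : ℝ) ^ θ / q k)) →
        (∀ ψ : ℝ → ℝ, IsCenteredBV ψ → ∀ k m t, 1 ≤ k → k ≤ m → m ≤ t → t ≤ n →
          |∫ x, ψ x * f k x * f m x * f t x ∂circleMeasure| ≤
            C * circleVariation ψ * u k * u m * u t * ((t : ℝ) ^ θ / q k)) →
        -- the normalization makes sense
        lpNorm (fun x => ∑ k ∈ Finset.Icc 1 n, f k x) 2 circleMeasure ≠ 0 →
        kolmogorovDist circleMeasure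
            (fun x => (∑ k ∈ Finset.Icc 1 n, f k x) /
              lpNorm (fun y => ∑ k ∈ Finset.Icc 1 n, f k y) 2 circleMeasure)
            (gaussianReal 0 1) (fun y => y) ≤
          K * ((Finset.Icc 1 n).sup' (Finset.nonempty_Icc.mpr hn) u /
              lpNorm (fun y => ∑ k ∈ Finset.Icc 1 n, f k y) 2 circleMeasure) ^ (2 / 3 : ℝ) *
            (n : ℝ) ^ (1 / 4 + δ) := by
  obtain ⟨K₀, hK₀, hBE⟩ := exists_kolmogorovDist_le
  by_cases hρ0 : 0 < ρ
  -- The exponent is one more than the power of `n` in the decorrelation error, so that `n` such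
  -- errors still sum to at most one.
  · obtain ⟨K₁, hK₁, hgap⟩ := exists_gap (D := C ^ 3) (p := 2 + |θ|) (by positivity)
      (by positivity) hρ0 hρ hδ
    refine ⟨1 + K₀ * K₁ ^ 4, by positivity, ?_⟩
    intro n hn q f u _ _ hlac hbv hnorm hvar h1 h2 _ hne
    obtain ⟨L, hL, hLη, hLK⟩ := hgap n hn
    obtain ⟨hU, hσ, hdist⟩ := normalized_sum hn hbv hnorm hne
    set U := (Finset.Icc 1 n).sup' (Finset.nonempty_Icc.mpr hn) u with hUdef
    set s := lpNorm (fun y => ∑ k ∈ Finset.Icc 1 n, f k y) 2 circleMeasure with hs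
    set R := (U / s) ^ (2 / 3 : ℝ) * (n : ℝ) ^ (1 / 4 + δ) with hR
    have hR0 : 0 ≤ R :=
      mul_nonneg (Real.rpow_nonneg (div_nonneg hU.le lpNorm_nonneg) _) (by positivity)
    rw [mul_assoc, ← hR]
    have hn1 : (1 : ℝ) ≤ n := by exact_mod_cast hn
    -- The distance never exceeds one, so only a rate `R < 1` needs an argument; then `R` itself is
    -- taken as the smoothing scale `ε`.
    rcases le_or_gt 1 R with hR1 | hR1
    · refine (kolmogorovDist_le_one _ _ _ _).trans ?_
      nlinarith [show 0 ≤ K₀ * K₁ ^ 4 * R by positivity]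
    · have huU : ∀ k, 1 ≤ k → k ≤ n → u k ≤ U := fun k hk1 hkn =>
        Finset.le_sup' u (Finset.mem_Icc.2 ⟨hk1, hkn⟩)
      obtain ⟨F, hFm, hF1, hFf, hFvar, hFdist⟩ := hdist
      have hu0 : ∀ k, 1 ≤ k → k ≤ n → 0 ≤ u k := fun k hk1 hkn =>
        lpNorm_nonneg.trans (hnorm k hk1 hkn)
      have hwd := isWeaklyDependent_of_lacunary hC hρ0 hρ hlac hbv hvar h1 h2 hU hu0 huU hL hFm hF1
        hFf
      have hσ0 : 0 < s / U := div_pos (lpNorm_nonneg.lt_of_ne' hne) hU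
      have hRσ : R = (1 / (s / U)) ^ (2 / 3 : ℝ) * (n : ℝ) ^ (1 / 4 + δ) := by
        rw [one_div_div]
      obtain ⟨hr1, hr2⟩ := smoothing_error_le_of_rate_lt_one hn1 hσ0 hδ (Nat.cast_nonneg L) hLK
        (hRσ ▸ hR1)
      rw [← hRσ] at hr1 hr2
      have hη : n * (C ^ 3 * (n : ℝ) ^ (1 + |θ|) * ρ ^ L) ≤ 1 := by
        have : (n : ℝ) ^ (2 + |θ|) = n * (n : ℝ) ^ (1 + |θ|) := by
          rw [← Real.rpow_one_add' (by positivity) (by positivity)]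
          congr 1
          ring
        calc _ = C ^ 3 * (n : ℝ) ^ (2 + |θ|) * ρ ^ L := by rw [this]; ring
          _ ≤ 1 := hLη
      have hRn : R * (s / U) ≤ n := (mul_le_of_le_one_left hσ0.le hR1.le).trans hσ
      rw [hFdist]
      refine (hBE hwd hn hL hη hσ0 hFvar hr1 hRn).trans ?_
      have := mul_le_mul_of_nonneg_left hr2 hK₀.le
      linarith
  -- For `ρ ≤ 0`, lacunarity at the indices `1` and `2` would bound a positive ratio by `C * ρ ≤ 0`.
  -- So `n = 1`, hence `s ≤ U`, and the right-hand side is at least one.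
  · refine ⟨1, one_pos, ?_⟩
    intro n hn q f u _ hq hlac hbv hnorm _ _ _ _ hne
    obtain ⟨hU, hσ, -⟩ := normalized_sum hn hbv hnorm hne
    have hn1 : n = 1 := by
      by_contra hn1
      have h := hlac 1 2 le_rfl one_lt_two (by omega)
      have h1 : 0 < (q 1 : ℝ) / q 2 :=
        div_pos (Nat.cast_pos.2 (hq 1 le_rfl hn)) (Nat.cast_pos.2 (hq 2 (by omega) (by omega)))
      rw [show 2 - 1 = 1 from rfl, pow_one] at h
      nlinarith
    subst hn1
    set U := (Finset.Icc 1 1).sup' (Finset.nonempty_Icc.mpr hn) u with hUdef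
    set s := lpNorm (fun y => ∑ k ∈ Finset.Icc 1 1, f k y) 2 circleMeasure with hs
    refine (kolmogorovDist_le_one _ _ _ _).trans ?_
    rw [Nat.cast_one, Real.one_rpow, one_mul, mul_one]
    refine Real.one_le_rpow ?_ (by norm_num)
    have hs0 : 0 < s := lpNorm_nonneg.lt_of_ne' hne
    rw [Nat.cast_one, div_le_one hU] at hσ
    rwa [le_div_iff₀ hs0, one_mul]
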